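/- Let $X$ be a smooth projective toric variety over an algebraically closed field $k$, let $S$ be its Cox ring, a $\operatorname{Pic}(X)$-graded polynomial ring, with irrelevant ideal $B$, and let $M$ be a finitely generated $\operatorname{Pic}(X)$-graded $S$-module with associated coherent sheaf $\widetilde M$ on $X$. A \emph{virtual resolution} of $M$ is a complex $F_\bullet=[F_0\leftarrow F_1\leftarrow\cdots]$ of finitely generated free graded $S$-modules such that $\widetilde F_\bullet$ is a locally free resolution of $\widetilde M$; $\operatorname{vdim} M$ is the minimal length of a virtual resolution of $M$; $\operatorname{codim} M$ is the codimension in $X$ of the support of $\widetilde M$, that is, the least height of a homogeneous prime $P\not\supseteq B$ of $S$ in the support of $M$ (this is the codimension of $S/\operatorname{Ann} M$ if $M$ is $B$-saturated). The module $M$ is \emph{virtually Cohen–Macaulay} if $\widetilde M\neq 0$ and $\operatorname{vdim} M=\operatorname{codim} M$. Suppose that the support $\mathcal X\subseteq X$ of $\widetilde M$ is equidimensional (all of its irreducible components have the same dimension) and is the disjoint union $\mathcal X=\bigsqcup_{i\in I} X_i$ of a finite nonempty family of closed subsets $X_i$. Let $M|_{X_i}$ be the quotient of $M$ by the submodule of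 the elements $m$ such that for every $P\in X_i$ (regarded as a homogeneous prime of $S$ not containing $B$) some homogeneous $f\notin P$ satisfies $fm=0$; its sheaf is the restriction of $\widetilde M$ to the open and closed subset $X_i$ of $\mathcal X$, extended by zero. If every $M|_{X_i}$ is virtually Cohen–Macaulay, then $M$ is virtually Cohen–Macaulay. -/

import Mathlib

open scoped NNReal

universe u v w

/-! ### Smooth projective toric varieties -/

/-- A smooth projective toric variety of dimension `n` with `r` torus-invariant prime divisors,
given by its fan in `ℝⁿ` (with lattice `ℤⁿ`).  The rays are indexed by `Fin r`, and a cone is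
recorded by the set of the rays that it contains. -/
structure SmoothProjectiveFan (n r : ℕ) where
  /-- the primitive generator of each ray -/
  ray : Fin r → Fin n → ℤ
  /-- the cones of the fan -/
  cones : Set (Finset (Fin r))
  singleton_mem : ∀ ρ, {ρ} ∈ cones
  /-- faces of cones are cones -/
  face_mem : ∀ σ ∈ cones, ∀ τ ⊆ σ, τ ∈ cones
  /-- two cones meet in a common face -/
  inter_le : ∀ σ ∈ cones, ∀ τ ∈ cones,
    PointedCone.hull ℝ ((fun ρ i => (ray ρ i : ℝ)) '' (σ : Set (Fin r))) ⊓
        PointedCone.hull ℝ ((fun ρ i => (ray ρ i : ℝ)) '' (τ : Set (Fin r))) ≤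
      PointedCone.hull ℝ ((fun ρ i => (ray ρ i : ℝ)) '' ((σ : Set (Fin r)) ∩ (τ : Set (Fin r))))
  /-- smoothness: the generators of a cone are part of a basis of the lattice -/
  smooth : ∀ σ ∈ cones, ∃ (b : Module.Basis (Fin n) ℤ (Fin n → ℤ)) (e : σ ↪ Fin n),
    ∀ ρ : σ, b (e ρ) = ray ρ
  /-- completeness: the cones cover `ℝⁿ` -/
  complete : ∀ v : Fin n → ℝ, ∃ σ ∈ cones,
    v ∈ PointedCone.hull ℝ ((fun ρ i => (ray ρ i : ℝ)) '' (σ : Set (Fin r)))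
  /-- projectivity: there is an ample divisor `∑ a_ρ D_ρ`, i.e. one whose support function
  (linear and equal to `m` on a maximal cone, with value `-a_ρ` at the ray `ρ`) is strictly
  convex -/
  projective : ∃ a : Fin r → ℤ, ∀ σ ∈ cones, σ.card = n → ∃ m : Fin n → ℤ,
    (∀ ρ ∈ σ, ray ρ ⬝ᵥ m = -a ρ) ∧ ∀ ρ ∉ σ, -a ρ < ray ρ ⬝ᵥ m

namespace SmoothProjectiveFan

variable {n r : ℕ} (X : SmoothProjectiveFan n r)

/-- The Picard group: torus-invariant divisors `ℤ^r` modulo the divisors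
`div(χ^m) = ∑ ⟨m, u_ρ⟩ D_ρ` of characters. -/
abbrev Pic : Type :=
  (Fin r → ℤ) ⧸ LinearMap.range (Matrix.mulVecLin (Matrix.of X.ray))

noncomputable instance : DecidableEq X.Pic := Classical.decEq _

/-- The class of the prime divisor `D_ρ`, which is the degree of the Cox variable `x_ρ`. -/
def divClass (ρ : Fin r) : X.Pic :=
  Submodule.Quotient.mk (Pi.single ρ 1)

variable (k : Type u) [Field k]

/-- The Cox ring. -/
abbrev Cox (_X : SmoothProjectiveFan n r) (k : Type u) [Field k] : Type u :=
  MvPolynomial (Fin r) k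

/-- The `Pic X`-grading of the Cox ring, `deg x_ρ = [D_ρ]`. -/
abbrev coxPiece : X.Pic → Submodule k (X.Cox k) :=
  MvPolynomial.weightedHomogeneousSubmodule k X.divClass

noncomputable instance : GradedAlgebra (X.coxPiece k) :=
  MvPolynomial.weightedGradedAlgebra k X.divClass

/-- The irrelevant ideal, generated by the monomials `∏_{ρ ∉ σ} x_ρ` for the cones `σ`. -/
noncomputable def irrelevantIdeal : Ideal (X.Cox k) :=
  Ideal.span {f | ∃ σ ∈ X.cones, f = ∏ ρ ∈ σᶜ, MvPolynomial.X ρ}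

/-- The points of the scheme `X`: homogeneous primes of the Cox ring that do not contain the
irrelevant ideal.  As a subtype of the prime spectrum it carries the Zariski topology. -/
abbrev Point : Type u :=
  {P : PrimeSpectrum (X.Cox k) //
    P.asIdeal.IsHomogeneous (X.coxPiece k) ∧ ¬ X.irrelevantIdeal k ≤ P.asIdeal}

/-- The monomials in the variables `x_ρ`, `ρ ∉ σ`.  Inverting them is the same as inverting
`∏_{ρ ∉ σ} x_ρ`. -/
noncomputable def chartSubmonoid (σ : Finset (Fin r)) : Submonoid (X.Cox k) :=
  Submonoid.closure {f | ∃ ρ ∉ σ, f = MvPolynomial.X ρ}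

theorem chartSubmonoid_le {σ τ : Finset (Fin r)} (h : τ ⊆ σ) :
    X.chartSubmonoid k σ ≤ X.chartSubmonoid k τ :=
  Submonoid.closure_mono fun _ ⟨ρ, hρ, hf⟩ => ⟨ρ, fun h' => hρ (h h'), hf⟩

/-- The coordinate ring of the affine open subset `U_σ` of `X`: the degree-zero part of the
localization of the Cox ring at the variables `x_ρ`, `ρ ∉ σ`. -/
abbrev chartRing (σ : Finset (Fin r)) : Type u :=
  HomogeneousLocalization (X.coxPiece k) (X.chartSubmonoid k σ)

end SmoothProjectiveFan

section

open SmoothProjectiveFan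

variable {n r : ℕ} {X : SmoothProjectiveFan n r} {k : Type u} [Field k]

/-! ### Graded modules -/

/-- A criterion for being the internal direct sum of a family of subgroups. -/
theorem isInternal_of_unique_sum {ι A B : Type*} [DecidableEq ι] [AddCommGroup A] [SetLike B A]
    [AddSubgroupClass B A] (p : ι → B)
    (h₁ : ∀ a, ∃ (s : Finset ι) (f : ι → A), (∀ i, f i ∈ p i) ∧ ∑ i ∈ s, f i = a)
    (h₂ : ∀ (s : Finset ι) (f : ι → A), (∀ i, f i ∈ p i) → ∑ i ∈ s, f i = 0 →
      ∀ i ∈ s, f i = 0) :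
    DirectSum.IsInternal p := by
  classical
  refine ⟨?_, fun a => ?_⟩
  · rw [injective_iff_map_eq_zero]
    intro x hx
    rw [DirectSum.coeAddMonoidHom_eq_dfinsuppSum] at hx
    ext i
    by_cases hi : i ∈ DFinsupp.support x
    · exact h₂ (DFinsupp.support x) (fun i => (x i : A)) (fun i => (x i).2) hx i hi
    · simpa using hi
  · obtain ⟨s, f, hf, rfl⟩ := h₁ a
    refine ⟨∑ i ∈ s, DirectSum.of (fun i => p i) i ⟨f i, hf i⟩, ?_⟩
    simp

theorem exists_sum_of_isInternal {ι A B : Type*} [DecidableEq ι] [AddCommGroup A] [SetLike B A]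
    [AddSubgroupClass B A] {p : ι → B} (h : DirectSum.IsInternal p) (a : A) :
    ∃ (s : Finset ι) (f : ι → A), (∀ i, f i ∈ p i) ∧ ∑ i ∈ s, f i = a := by
  classical
  obtain ⟨x, rfl⟩ := h.2 a
  refine ⟨DFinsupp.support x, fun i => x i, fun i => (x i).2, ?_⟩
  rw [DirectSum.coeAddMonoidHom_eq_dfinsuppSum]
  rfl

theorem eq_zero_of_isInternal {ι A B : Type*} [DecidableEq ι] [AddCommGroup A] [SetLike B A]
    [AddSubgroupClass B A] {p : ι → B} (h : DirectSum.IsInternal p) (s : Finset ι) (f : ι → A)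
    (hf : ∀ i, f i ∈ p i) (h0 : ∑ i ∈ s, f i = 0) : ∀ i ∈ s, f i = 0 := by
  classical
  have hx : ∑ i ∈ s, DirectSum.of (fun i => p i) i ⟨f i, hf i⟩ = 0 := by
    apply h.1
    simpa using h0
  intro i hi
  have h1 := congrArg (fun x => x i) hx
  have h2 : (∑ j ∈ s, DirectSum.of (fun i => p i) j ⟨f j, hf j⟩) i = ⟨f i, hf i⟩ := by
    rw [DFinsupp.finsetSum_apply, Finset.sum_eq_single i]
    · exact DirectSum.of_eq_same _ _
    · exact fun j _ hj => DirectSum.of_eq_of_ne _ _ _ hj.symm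
    · exact fun h => absurd hi h
  exact congrArg Subtype.val (h2.symm.trans h1)

/-- A `Pic X`-graded module over the Cox ring of `X`. -/
structure GradedModule (X : SmoothProjectiveFan n r) (k : Type u) [Field k] where
  carrier : Type v
  [addCommGroup : AddCommGroup carrier]
  [module : Module (X.Cox k) carrier]
  /-- the homogeneous elements of a given degree -/
  piece : X.Pic → AddSubgroup carrier
  isInternal : DirectSum.IsInternal piece
  smul_mem : ∀ {d e : X.Pic} {f : X.Cox k} {m : carrier},
    f ∈ X.coxPiece k d → m ∈ piece e → f • m ∈ piece (d + e)

namespace GradedModule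

attribute [instance] GradedModule.addCommGroup GradedModule.module

/-- Degree-preserving homomorphisms of graded modules. -/
structure Hom (M : GradedModule.{u, v} X k) (N : GradedModule.{u, w} X k) where
  toLinearMap : M.carrier →ₗ[X.Cox k] N.carrier
  map_mem : ∀ {d : X.Pic} {m : M.carrier}, m ∈ M.piece d → toLinearMap m ∈ N.piece d

/-- The free graded module `⨁_j S(-a_j)` on generators of degrees `a_j`. -/
noncomputable def free (X : SmoothProjectiveFan n r) (k : Type u) [Field k]
    {J : Type} [Fintype J] (a : J → X.Pic) : GradedModule.{u, u} X k where
  carrier := J → X.Cox k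
  piece d :=
    { carrier := {v | ∀ j, v j ∈ X.coxPiece k (d - a j)}
      add_mem' := fun hv hw j => add_mem (hv j) (hw j)
      zero_mem' := fun j => zero_mem _
      neg_mem' := fun hv j => neg_mem (hv j) }
  isInternal := by
    classical
    have hS := DirectSum.Decomposition.isInternal (X.coxPiece k)
    refine isInternal_of_unique_sum _ (fun v => ?_) (fun s f hf h0 d hd => ?_)
    · choose s g hg hsum using fun j => exists_sum_of_isInternal hS (v j)
      refine ⟨Finset.univ.biUnion fun j => (s j).image (· + a j),
        fun d j => if d - a j ∈ s j then g j (d - a j) else 0, fun d j => ?_, ?_⟩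
      · dsimp only
        split_ifs
        · exact hg j _
        · exact zero_mem _
      · funext j
        rw [Finset.sum_apply, ← hsum j]
        rw [← Finset.sum_subset (s₁ := (s j).image (· + a j))]
        · rw [Finset.sum_image (fun x _ y _ h => add_right_cancel h)]
          exact Finset.sum_congr rfl fun i hi => by simp [hi]
        · exact Finset.subset_biUnion_of_mem (fun j => (s j).image (· + a j)) (Finset.mem_univ j)
        · intro d _ hd
          refine if_neg fun h => hd ?_
          exact Finset.mem_image.2 ⟨d - a j, h, by simp⟩
    · funext j
      have h0j : ∑ i ∈ s.image (· - a j), f (i + a j) j = 0 := by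
        rw [Finset.sum_image (fun x _ y _ h => sub_left_injective h)]
        simpa using congrFun h0 j
      have := eq_zero_of_isInternal hS _ (fun i => f (i + a j) j)
        (fun i => by simpa using hf (i + a j) j) h0j (d - a j)
        (Finset.mem_image_of_mem _ hd)
      simpa using this
  smul_mem := by
    intro d e f m hf hm j
    have := SetLike.mul_mem_graded (A := X.coxPiece k) hf (hm j)
    rwa [← add_sub_assoc] at this

/-! ### Sheafification, by its sections over the charts `U_σ` -/

noncomputable instance localizedModuleModule {A : Type*} [AddCommGroup A] [Module (X.Cox k) A]
    (T : Submonoid (X.Cox k)) :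
    Module (HomogeneousLocalization (X.coxPiece k) T) (LocalizedModule T A) :=
  Module.compHom _ (algebraMap (HomogeneousLocalization (X.coxPiece k) T) (Localization T))

/-- The sections over `U_σ` of the sheaf `M~` on `X`: the degree-zero part of the localization
of `M` at the variables `x_ρ`, `ρ ∉ σ`, as a module over the coordinate ring of `U_σ`. -/
noncomputable def chart (M : GradedModule.{u, v} X k) (σ : Finset (Fin r)) :
    Submodule (X.chartRing k σ) (LocalizedModule (X.chartSubmonoid k σ) M.carrier) where
  carrier := {y | ∃ (d : X.Pic) (m : M.carrier) (s : X.chartSubmonoid k σ),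
    m ∈ M.piece d ∧ (s : X.Cox k) ∈ X.coxPiece k d ∧ y = LocalizedModule.mk m s}
  zero_mem' := ⟨0, 0, 1, zero_mem _, SetLike.GradedOne.one_mem, by simp⟩
  add_mem' := by
    rintro _ _ ⟨d, m, s, hm, hs, rfl⟩ ⟨e, m', t, hm', ht, rfl⟩
    refine ⟨d + e, t • m + s • m', s * t, ?_, SetLike.mul_mem_graded hs ht,
      LocalizedModule.mk_add_mk⟩
    refine add_mem ?_ (M.smul_mem hs hm')
    rw [add_comm]
    exact M.smul_mem ht hm
  smul_mem' := by
    rintro c _ ⟨d, m, s, hm, hs, rfl⟩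
    obtain ⟨c, rfl⟩ := HomogeneousLocalization.mk_surjective c
    refine ⟨c.deg + d, (c.num : X.Cox k) • m, ⟨c.den, c.den_mem⟩ * s, M.smul_mem c.num.2 hm,
      SetLike.mul_mem_graded c.den.2 hs, ?_⟩
    exact LocalizedModule.mk_smul_mk _ _ _ _

/-- The restriction of sections from `U_σ` to the open subset `U_τ`, for a face `τ` of `σ`. -/
noncomputable def res (M : GradedModule.{u, v} X k) {σ τ : Finset (Fin r)} (h : τ ⊆ σ) :
    M.chart σ →+ M.chart τ where
  toFun y := ⟨LocalizedModule.liftOfLE _ _ (X.chartSubmonoid_le k h) y.1, by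
    obtain ⟨_, d, m, s, hm, hs, rfl⟩ := y
    refine ⟨d, m, ⟨s, X.chartSubmonoid_le k h s.2⟩, hm, hs, ?_⟩
    simpa [← IsLocalizedModule.mk_eq_mk'] using
      IsLocalizedModule.liftOfLE_mk' _ _ (X.chartSubmonoid_le k h)
        (LocalizedModule.mkLinearMap (X.chartSubmonoid k σ) M.carrier)
        (LocalizedModule.mkLinearMap (X.chartSubmonoid k τ) M.carrier) m s⟩
  map_zero' := by ext; simp
  map_add' := by intros; ext; simp

/-- A homomorphism `M~ → N~` of sheaves of `𝒪_X`-modules: compatible linear maps of the sections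
over the affine charts. -/
structure SheafHom (M : GradedModule.{u, v} X k) (N : GradedModule.{u, w} X k) where
  app : ∀ σ ∈ X.cones, M.chart σ →ₗ[X.chartRing k σ] N.chart σ
  naturality : ∀ {σ τ : Finset (Fin r)} (hσ : σ ∈ X.cones) (hτ : τ ∈ X.cones) (h : τ ⊆ σ)
    (y : M.chart σ), app τ hτ (M.res h y) = N.res h (app σ hσ y)

/-- The map on sections over `U_σ` induced by a homomorphism of graded modules. -/
noncomputable def Hom.chart {M : GradedModule.{u, v} X k} {N : GradedModule.{u, w} X k}
    (f : M.Hom N) (σ : Finset (Fin r)) : M.chart σ →ₗ[X.chartRing k σ] N.chart σ where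
  toFun y := ⟨LocalizedModule.map (X.chartSubmonoid k σ) f.toLinearMap y.1, by
    obtain ⟨_, d, m, s, hm, hs, rfl⟩ := y
    exact ⟨d, f.toLinearMap m, s, f.map_mem hm, hs, by simp [LocalizedModule.map_mk]⟩⟩
  map_add' := by intros; ext; simp
  map_smul' := by
    intro c y
    ext
    exact map_smul (LocalizedModule.map (X.chartSubmonoid k σ) f.toLinearMap)
      (algebraMap (X.chartRing k σ) (Localization (X.chartSubmonoid k σ)) c) y.1

/-- The sheaf `M~` is nonzero. -/
def SheafNeZero (M : GradedModule.{u, v} X k) : Prop :=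
  ∃ σ ∈ X.cones, Nontrivial (M.chart σ)

/-! ### Support, codimension, restriction -/

/-- The support of the sheaf `M~`, a subset of `X`. -/
def support (M : GradedModule.{u, v} X k) : Set (X.Point k) :=
  {P | P.1 ∈ Module.support (X.Cox k) M.carrier}

/-- The codimension in `X` of the support of `M~`. -/
noncomputable def codim (M : GradedModule.{u, v} X k) : ℕ∞ :=
  ⨅ P ∈ M.support, P.1.asIdeal.height

/-- The support of `M~` is equidimensional: all its irreducible components have the same
dimension.  The irreducible component with generic point `P` has dimension
`dim S/P - rank (Pic X)`. -/
def EquidimensionalSupport (M : GradedModule.{u, v} X k) : Prop :=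
  ∀ P Q : X.Point k, Minimal (· ∈ M.support) P → Minimal (· ∈ M.support) Q →
    ringKrullDim (X.Cox k ⧸ P.1.asIdeal) = ringKrullDim (X.Cox k ⧸ Q.1.asIdeal)

/-- The elements of `M` whose germs at all points of `Z` (in the sheaf `⨁_d M(d)~`) vanish. -/
def vanishingOn (M : GradedModule.{u, v} X k) (Z : Set (X.Point k)) :
    Submodule (X.Cox k) M.carrier where
  carrier := {m | ∀ P ∈ Z, ∃ (d : X.Pic) (f : X.Cox k),
    f ∈ X.coxPiece k d ∧ f ∉ P.1.asIdeal ∧ f • m = 0}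
  zero_mem' P _ := ⟨0, 1, SetLike.GradedOne.one_mem,
    (Ideal.ne_top_iff_one _).1 P.1.isPrime.ne_top, smul_zero _⟩
  add_mem' := by
    intro a b ha hb P hP
    obtain ⟨d, f, hf, hfP, hfa⟩ := ha P hP
    obtain ⟨e, g, hg, hgP, hgb⟩ := hb P hP
    refine ⟨d + e, f * g, SetLike.mul_mem_graded hf hg, ?_, ?_⟩
    · exact fun h => (P.1.isPrime.mem_or_mem h).elim hfP hgP
    · rw [smul_add, mul_smul f g b, hgb, mul_comm, mul_smul g f a, hfa, smul_zero, smul_zero,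
        add_zero]
  smul_mem' := by
    intro c a ha P hP
    obtain ⟨d, f, hf, hfP, hfa⟩ := ha P hP
    exact ⟨d, f, hf, hfP, by rw [smul_comm, hfa, smul_zero]⟩

/-- The module of the restriction of `M` to `Z`: the image of `M` in the product of its
localizations at the points of `Z`.  If the support of `M~` is the disjoint union of `Z` and
another closed subset, its sheaf is the restriction of `M~` to `Z`, i.e. it has the same stalks as
`M~` at the points of `Z`, and zero stalks elsewhere. -/
noncomputable def restrict (M : GradedModule.{u, v} X k) (Z : Set (X.Point k)) :
    GradedModule.{u, v} X k where
  carrier := M.carrier ⧸ M.vanishingOn Z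
  piece d := (M.piece d).map (M.vanishingOn Z).mkQ.toAddMonoidHom
  isInternal := by
    classical
    refine isInternal_of_unique_sum _ (fun a => ?_) (fun s f hf h0 => ?_)
    · obtain ⟨m, rfl⟩ := Submodule.mkQ_surjective _ a
      obtain ⟨s, f, hf, rfl⟩ := exists_sum_of_isInternal M.isInternal m
      exact ⟨s, fun i => (M.vanishingOn Z).mkQ (f i), fun i => ⟨f i, hf i, rfl⟩,
        by rw [map_sum]⟩
    · choose g hg hgf using hf
      have hgf' : ∀ i, (M.vanishingOn Z).mkQ (g i) = f i := hgf
      have hK : ∑ i ∈ s, g i ∈ M.vanishingOn Z := by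
        rw [← Submodule.Quotient.mk_eq_zero, ← Submodule.mkQ_apply, map_sum, ← h0]
        exact Finset.sum_congr rfl fun i _ => hgf' i
      intro i hi
      rw [← hgf', Submodule.mkQ_apply, Submodule.Quotient.mk_eq_zero]
      intro P hP
      obtain ⟨d, c, hc, hcP, h⟩ := hK P hP
      refine ⟨d, c, hc, hcP, ?_⟩
      rw [Finset.smul_sum] at h
      have hsum : ∑ e ∈ s.image (d + ·), c • g (e - d) = 0 := by
        rw [Finset.sum_image (fun x _ y _ h => add_left_cancel h)]
        simpa using h
      have := eq_zero_of_isInternal M.isInternal _ (fun e => c • g (e - d))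
        (fun e => by simpa using M.smul_mem hc (hg (e - d))) hsum (d + i)
        (Finset.mem_image_of_mem _ hi)
      simpa using this
  smul_mem := by
    rintro d e f _ hf ⟨m, hm, rfl⟩
    exact ⟨f • m, M.smul_mem hf hm, map_smul (M.vanishingOn Z).mkQ f m⟩

/-! ### Virtual resolutions -/

end GradedModule

/-- A complex `F₀ ← F₁ ← ⋯` of finitely generated free graded modules. -/
structure FreeComplex (X : SmoothProjectiveFan n r) (k : Type u) [Field k] where
  /-- the generators of `F i` -/
  gen : ℕ → Type
  [fintype : ∀ i, Fintype (gen i)]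
  /-- the degrees of the generators -/
  deg : ∀ i, gen i → X.Pic
  d : ∀ i, (GradedModule.free X k (deg (i + 1))).Hom (GradedModule.free X k (deg i))
  d_comp_d : ∀ i, (d i).toLinearMap ∘ₗ (d (i + 1)).toLinearMap = 0

attribute [instance] FreeComplex.fintype

namespace GradedModule

/-- `F` is a virtual resolution of `M`: the complex of vector bundles `F~` is a resolution of the
sheaf `M~`, i.e. `⋯ → F₁~ → F₀~ → M~ → 0` is exact for some homomorphism of sheaves
`F₀~ → M~` (exactness being checked on the affine charts). -/
def IsVirtualResolution (M : GradedModule.{u, v} X k) (F : FreeComplex X k) : Prop :=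
  ∃ ε : SheafHom (free X k (F.deg 0)) M, ∀ (σ : Finset (Fin r)) (hσ : σ ∈ X.cones),
    Function.Surjective (ε.app σ hσ) ∧
    Function.Exact ((F.d 0).chart σ) (ε.app σ hσ) ∧
    ∀ i, Function.Exact ((F.d (i + 1)).chart σ) ((F.d i).chart σ)

/-- The virtual dimension: the minimal length of a virtual resolution. -/
noncomputable def vdim (M : GradedModule.{u, v} X k) : ℕ∞ :=
  sInf {ℓ | ∃ (L : ℕ) (F : FreeComplex X k), ℓ = L ∧ (∀ i, L < i → IsEmpty (F.gen i)) ∧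
    M.IsVirtualResolution F}

/-- `M` is virtually Cohen–Macaulay. -/
def IsVirtuallyCohenMacaulay (M : GradedModule.{u, v} X k) : Prop :=
  M.SheafNeZero ∧ M.vdim = M.codim

end GradedModule

end

/-!
For every `M` with nonzero sheaf, `codim M ≤ vdim M`: choose an associated point `P` of `M` on an
affine chart. After localization at `P`, a virtual resolution of `M` becomes a complex of flat
modules over the regular local ring `S_P` that is exact in positive degrees, and the cokernel of
its last map contains an element with annihilator the maximal ideal. Dividing out a regular
sequence of length `ht P` one element at a time shortens the complex by one each time, so the
complex has length at least `ht P ≥ codim M`.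

Conversely, the sheaf of `M` is the direct sum of the sheaves of the `M|_{X_i}`, so the direct sum
of minimal virtual resolutions of the `M|_{X_i}` is a virtual resolution of `M`. Its length is
`max codim M|_{X_i}`, and all these codimensions equal `codim M`: the minimal primes of the support
have equal dimension, hence equal height by the dimension formula for polynomial rings.
-/

/-! ### Regular local rings -/

section RegularLocalRing

open IsLocalRing RingTheory.Sequence

theorem exists_span_insert_eq_of_notMem_maximalIdeal_smul {R A : Type*} [CommRing R]
    [IsLocalRing R] [AddCommGroup A] [Module R A] {N : Submodule R A} (hN : N.FG) {x : A}
    (hx : x ∈ N) (hx' : x ∉ maximalIdeal R • N) :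
    ∃ t : Finset A, t.card + 1 = N.spanFinrank ∧ Submodule.span R (insert x (t : Set A)) = N := by
  classical
  obtain ⟨s, hcard, hs⟩ := Submodule.FG.exists_span_finset_card_eq_spanFinrank hN
  obtain ⟨f, -, hf⟩ := Submodule.mem_span_finset.1 (hs.symm ▸ hx)
  have hsN : ∀ y ∈ s, y ∈ N := fun y hy => hs ▸ Submodule.subset_span hy
  obtain ⟨y, hy, hfy⟩ : ∃ y ∈ s, f y ∉ maximalIdeal R := by
    by_contra! h
    exact hx' (hf ▸ Submodule.sum_mem _ fun y hy => Submodule.smul_mem_smul (h y hy) (hsN y hy))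
  have hunit : IsUnit (f y) := by simpa using hfy
  refine ⟨s.erase y, by rw [Finset.card_erase_add_one hy, hcard], le_antisymm ?_ ?_⟩
  · exact Submodule.span_le.2 (Set.insert_subset hx fun z hz => hsN z (Finset.mem_of_mem_erase hz))
  · set W := Submodule.span R (insert x (s.erase y : Set A))
    have hW : ∀ z ∈ s.erase y, z ∈ W :=
      fun z hz => Submodule.subset_span (Set.mem_insert_of_mem _ hz)
    have hyW : f y • y ∈ W := by
      rw [← Finset.add_sum_erase s (fun z => f z • z) hy, ← eq_sub_iff_add_eq] at hf
      rw [hf]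
      exact sub_mem (Submodule.subset_span (Set.mem_insert _ _))
        (Submodule.sum_mem _ fun z hz => Submodule.smul_mem _ _ (hW z hz))
    rw [← hs, Submodule.span_le]
    intro z hz
    by_cases hzy : z = y
    · exact hzy ▸ (Submodule.smul_mem_iff_of_isUnit W hunit).1 hyW
    · exact hW z (Finset.mem_erase.2 ⟨hzy, hz⟩)

theorem isLocalRing_quotient_span_singleton {R : Type*} [CommRing R] [IsLocalRing R] {x : R}
    (hx : x ∈ maximalIdeal R) : IsLocalRing (R ⧸ Ideal.span {x}) :=
  have : Nontrivial (R ⧸ Ideal.span {x}) := Ideal.Quotient.nontrivial_iff.2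
    ((Ideal.span_singleton_le_iff_mem _).2 hx |>.trans_lt (maximalIdeal.isMaximal R).lt_top).ne
  IsLocalRing.of_surjective' _ Ideal.Quotient.mk_surjective

theorem spanFinrank_maximalIdeal_quotient_succ_le {R : Type*} [CommRing R] [IsLocalRing R]
    [IsNoetherianRing R] {x : R} [IsLocalRing (R ⧸ Ideal.span {x})] (hx : x ∈ maximalIdeal R)
    (hx2 : x ∉ maximalIdeal R ^ 2) :
    (maximalIdeal (R ⧸ Ideal.span {x})).spanFinrank + 1 ≤ (maximalIdeal R).spanFinrank := by
  obtain ⟨t, hcard, ht⟩ := exists_span_insert_eq_of_notMem_maximalIdeal_smul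
    (maximalIdeal R).fg_of_isNoetherianRing hx (by rwa [smul_eq_mul, ← pow_two])
  have hspan : maximalIdeal (R ⧸ Ideal.span {x}) =
      Ideal.span (Ideal.Quotient.mk (Ideal.span {x}) '' t) := by
    rw [← map_maximalIdeal_of_surjective _ Ideal.Quotient.mk_surjective, ← ht, ← Ideal.span,
      Ideal.span_insert, Ideal.map_sup, Ideal.map_quotient_self, bot_sup_eq, Ideal.map_span]
  rw [hspan, ← hcard]
  gcongr
  calc _ ≤ (Ideal.Quotient.mk (Ideal.span {x}) '' (t : Set R)).ncard :=
        Submodule.spanFinrank_span_le_ncard_of_finite (t.finite_toSet.image _)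
    _ ≤ t.card := (Set.ncard_image_le t.finite_toSet).trans_eq (Set.ncard_coe_finset t)

variable {R : Type*} [CommRing R] [IsRegularLocalRing R]

theorem isRegularLocalRing_quotient_span_singleton {x : R} (hx : x ∈ maximalIdeal R)
    (hx2 : x ∉ maximalIdeal R ^ 2) : IsRegularLocalRing (R ⧸ Ideal.span {x}) := by
  have := isLocalRing_quotient_span_singleton hx
  refine .of_spanFinrank_maximalIdeal_le _ (ENat.WithBot.add_le_add_one_right_iff.1 ?_)
  calc ((maximalIdeal (R ⧸ Ideal.span {x})).spanFinrank : WithBot ℕ∞) + 1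
      ≤ (maximalIdeal R).spanFinrank := by
        exact_mod_cast spanFinrank_maximalIdeal_quotient_succ_le hx hx2
    _ = ringKrullDim R := IsRegularLocalRing.spanFinrank_maximalIdeal
    _ ≤ ringKrullDim (R ⧸ Ideal.span {x}) + 1 := by
      rw [← maximalIdeal_height_eq_ringKrullDim]
      exact Ideal.height_le_ringKrullDim_quotient_add_one hx

theorem spanFinrank_maximalIdeal_quotient_succ {x : R} [IsLocalRing (R ⧸ Ideal.span {x})]
    (hx : x ∈ maximalIdeal R) (hx2 : x ∉ maximalIdeal R ^ 2) :
    (maximalIdeal (R ⧸ Ideal.span {x})).spanFinrank + 1 = (maximalIdeal R).spanFinrank := by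
  refine le_antisymm (spanFinrank_maximalIdeal_quotient_succ_le hx hx2) ?_
  have := isRegularLocalRing_quotient_span_singleton hx hx2
  have hdim := Ideal.height_le_ringKrullDim_quotient_add_one hx
  rw [maximalIdeal_height_eq_ringKrullDim, ← IsRegularLocalRing.spanFinrank_maximalIdeal,
    ← IsRegularLocalRing.spanFinrank_maximalIdeal] at hdim
  exact_mod_cast hdim

theorem maximalIdeal_notMem_minimalPrimes (h : (maximalIdeal R).spanFinrank ≠ 0) :
    maximalIdeal R ∉ minimalPrimes R := by
  intro hmin
  have hdim := maximalIdeal_height_eq_ringKrullDim (R := R)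
  rw [Ideal.height_eq_zero_iff.2 hmin, ← IsRegularLocalRing.spanFinrank_maximalIdeal] at hdim
  exact h (by exact_mod_cast hdim.symm)

theorem exists_mem_maximalIdeal_notMem_sq_notMem_minimalPrimes {R : Type*} [CommRing R]
    [IsLocalRing R] [IsNoetherianRing R] (h : maximalIdeal R ∉ minimalPrimes R) :
    ∃ x ∈ maximalIdeal R, x ∉ maximalIdeal R ^ 2 ∧ ∀ p ∈ minimalPrimes R, x ∉ p := by
  classical
  have hfin := minimalPrimes.finite_of_isNoetherianRing R
  have hsq : ¬ maximalIdeal R ≤ maximalIdeal R ^ 2 := by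
    intro hle
    have hbot : maximalIdeal R = ⊥ := Submodule.eq_bot_of_le_smul_of_le_jacobson_bot
      (maximalIdeal R) _ (maximalIdeal R).fg_of_isNoetherianRing
      (by rwa [smul_eq_mul, ← pow_two]) (maximalIdeal_le_jacobson _)
    exact h ⟨⟨inferInstance, bot_le⟩, fun p _ _ => hbot ▸ bot_le⟩
  by_contra! hcover
  have hsub : (maximalIdeal R : Set R) ⊆
      ⋃ p ∈ (↑(insert (maximalIdeal R ^ 2) hfin.toFinset) : Set (Ideal R)), (p : Set R) := by
    intro x hx
    by_cases hx2 : x ∈ maximalIdeal R ^ 2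
    · exact Set.mem_biUnion (Finset.mem_insert_self _ _) hx2
    · obtain ⟨p, hp, hxp⟩ := hcover x hx hx2
      exact Set.mem_biUnion (Finset.mem_insert_of_mem (hfin.mem_toFinset.2 hp)) hxp
  obtain ⟨p, hp, hle⟩ := (Ideal.subset_union_prime (f := id) (maximalIdeal R ^ 2)
    (maximalIdeal R ^ 2) fun p hp hp' _ =>
      (hfin.mem_toFinset.1 ((Finset.mem_insert.1 hp).resolve_left hp')).1.1).1 hsub
  rcases Finset.mem_insert.1 hp with rfl | hp
  · exact hsq hle
  · have hp := hfin.mem_toFinset.1 hp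
    exact h ((maximalIdeal.isMaximal R).eq_of_le hp.1.1.ne_top hle ▸ hp)

theorem isDomain_of_isPrime_span_singleton_of_notMem_minimalPrimes {R : Type*} [CommRing R]
    [IsLocalRing R] [IsNoetherianRing R] {x : R} (hx : x ∈ maximalIdeal R)
    (hprime : (Ideal.span {x}).IsPrime) (hmin : ∀ p ∈ minimalPrimes R, x ∉ p) : IsDomain R := by
  obtain ⟨p, hp, hpx⟩ := Ideal.exists_minimalPrimes_le (bot_le : (⊥ : Ideal R) ≤ Ideal.span {x})
  have hpp : p.IsPrime := hp.1.1
  have hbot : p = ⊥ := by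
    refine Submodule.eq_bot_of_le_smul_of_le_jacobson_bot (maximalIdeal R) _
      p.fg_of_isNoetherianRing (fun y hy => ?_) (maximalIdeal_le_jacobson _)
    obtain ⟨a, rfl⟩ := Ideal.mem_span_singleton'.1 (hpx hy)
    rw [smul_eq_mul, mul_comm a]
    exact Ideal.mul_mem_mul hx ((hpp.mem_or_mem hy).resolve_right (hmin p hp))
  subst hbot
  exact IsDomain.of_bot_isPrime R

theorem isDomain_of_isRegularLocalRing (R : Type*) [CommRing R] [IsRegularLocalRing R] :
    IsDomain R := by
  induction hn : (maximalIdeal R).spanFinrank generalizing R with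
  | zero =>
    exact (isField_iff_maximalIdeal_eq.2 ((Submodule.spanFinrank_eq_zero_iff_eq_bot
      (maximalIdeal R).fg_of_isNoetherianRing).1 hn)).isDomain
  | succ n ih =>
    obtain ⟨x, hx, hx2, hmin⟩ := exists_mem_maximalIdeal_notMem_sq_notMem_minimalPrimes
      (maximalIdeal_notMem_minimalPrimes (R := R) (by omega))
    have := isRegularLocalRing_quotient_span_singleton hx hx2
    have hdom := ih (R ⧸ Ideal.span {x})
      (by have := spanFinrank_maximalIdeal_quotient_succ hx hx2; omega)
    exact isDomain_of_isPrime_span_singleton_of_notMem_minimalPrimes hx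
      ((Ideal.Quotient.isDomain_iff_prime _).1 hdom) hmin

theorem exists_isWeaklyRegular_of_isRegularLocalRing (R : Type*) [CommRing R]
    [IsRegularLocalRing R] :
    ∃ rs : List R, rs.length = (maximalIdeal R).spanFinrank ∧ (∀ r ∈ rs, r ∈ maximalIdeal R) ∧
      IsWeaklyRegular R rs := by
  induction hn : (maximalIdeal R).spanFinrank generalizing R with
  | zero => exact ⟨[], rfl, by simp, .nil R R⟩
  | succ n ih =>
    have := isDomain_of_isRegularLocalRing R
    obtain ⟨x, hx, hx2, -⟩ := exists_mem_maximalIdeal_notMem_sq_notMem_minimalPrimes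
      (maximalIdeal_notMem_minimalPrimes (R := R) (by omega))
    have := isRegularLocalRing_quotient_span_singleton hx hx2
    obtain ⟨rs, hlen, hmem, hrs⟩ := ih (R ⧸ Ideal.span {x})
      (by have := spanFinrank_maximalIdeal_quotient_succ hx hx2; omega)
    obtain ⟨rs, rfl⟩ := List.map_surjective_iff.2 Ideal.Quotient.mk_surjective rs
    have hx0 : x ≠ 0 := fun h => hx2 (h ▸ zero_mem _)
    have e : (R ⧸ Ideal.span {x}) ≃ₗ[R] QuotSMulTop x R := Submodule.quotEquivOfEq _ _ (by
      rw [← Submodule.ideal_span_singleton_smul, smul_eq_mul, Ideal.mul_top])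
    refine ⟨x :: rs, by simpa using hlen, List.forall_mem_cons.2 ⟨hx, fun r hr => ?_⟩,
      .cons (fun a b hab => mul_left_cancel₀ hx0 hab) ((e.isWeaklyRegular_congr rs).1
        ((isWeaklyRegular_map_algebraMap_iff (R ⧸ Ideal.span {x}) _ rs).1 hrs))⟩
    have := IsLocalHom.of_surjective _ (Ideal.Quotient.mk_surjective (I := Ideal.span {x}))
    rw [← maximalIdeal_comap (Ideal.Quotient.mk (Ideal.span {x}))]
    exact hmem _ (List.mem_map_of_mem hr)

end RegularLocalRing

/-! ### Heights of primes in polynomial rings -/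

section Height

open Polynomial

theorem height_add_ringKrullDim_quotient_le {R : Type*} [CommRing R] (P : Ideal R)
    [hP : P.IsPrime] : (P.height : WithBot ℕ∞) + ringKrullDim (R ⧸ P) ≤ ringKrullDim R := by
  let p : PrimeSpectrum R := ⟨P, hP⟩
  have : Nonempty (PrimeSpectrum R) := ⟨p⟩
  have hcoheight : ringKrullDim (R ⧸ P) = Order.coheight p := by
    rw [ringKrullDim_quotient, Order.coheight_eq_krullDim_Ici]
    rfl
  rw [hcoheight, PrimeSpectrum.height_eq_orderHeight p, ringKrullDim,
    Order.krullDim_eq_iSup_height_add_coheight_of_nonempty, ← WithBot.coe_add, WithBot.coe_le_coe]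
  exact le_iSup (fun q : PrimeSpectrum R => Order.height q + Order.coheight q) p

theorem ringKrullDim_le_of_isIntegral_of_injective {R S : Type*} [CommRing R]
    [CommRing S] [IsDomain S] [Algebra R S] [Algebra.IsIntegral R S]
    (h : Function.Injective (algebraMap R S)) : ringKrullDim R ≤ ringKrullDim S := by
  refine iSup_le fun l => ?_
  obtain ⟨Q, hQ, hQl⟩ := Ideal.exists_ideal_over_prime_of_isIntegral_of_isDomain (S := S)
    l.head.asIdeal (by rw [(RingHom.injective_iff_ker_eq_bot _).1 h]; exact bot_le)
  have : Q.LiesOver l.head.asIdeal := ⟨hQl.symm⟩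
  obtain ⟨L, hL, -⟩ := Ideal.exists_ltSeries_of_hasGoingUp l Q
  rw [← hL]
  exact le_iSup (fun L : LTSeries (PrimeSpectrum S) => (L.length : WithBot ℕ∞)) L

theorem toENat_trdeg_le_ringKrullDim (k B : Type u) [Field k] [CommRing B] [IsDomain B]
    [Algebra k B] [Algebra.FiniteType k B] :
    (Cardinal.toENat (Algebra.trdeg k B) : WithBot ℕ∞) ≤ ringKrullDim B := by
  obtain ⟨t, g, hg, hint⟩ := exists_integral_inj_algHom_of_fg k B
  algebraize [g.toRingHom]
  have : IsScalarTower k (MvPolynomial (Fin t) k) B :=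
    .of_algebraMap_eq fun x => (g.commutes x).symm
  have hinj : Function.Injective (algebraMap (MvPolynomial (Fin t) k) B) := hg
  have : FaithfulSMul (MvPolynomial (Fin t) k) B :=
    (faithfulSMul_iff_algebraMap_injective _ _).2 hinj
  have : Algebra.IsIntegral (MvPolynomial (Fin t) k) B := ⟨hint⟩
  have htrdeg := trdeg_add_eq k (MvPolynomial (Fin t) k) (A := B)
  rw [trdeg_eq_zero (R := MvPolynomial (Fin t) k), add_zero, MvPolynomial.trdeg_of_isDomain]
    at htrdeg
  have hdim := ringKrullDim_le_of_isIntegral_of_injective hinj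
  rw [MvPolynomial.ringKrullDim_of_isNoetherianRing, ringKrullDim_eq_zero_of_field] at hdim
  simpa [← htrdeg] using hdim

theorem liesOver_map_C {A : Type*} [CommRing A] (p : Ideal A) :
    (p.map (C : A →+* A[X])).LiesOver p := by
  refine ⟨Ideal.ext fun a => ⟨Ideal.mem_map_of_mem C, fun ha => ?_⟩⟩
  simpa using Ideal.mem_map_C_iff.1 ha 0

theorem height_le_height_map_C {A : Type*} [CommRing A] [IsNoetherianRing A] (p : Ideal A)
    [p.IsPrime] : p.height ≤ (p.map (C : A →+* A[X])).height := by
  have : (p.map (C : A →+* A[X])).IsPrime := Ideal.isPrime_map_C_of_isPrime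
  have := liesOver_map_C p
  rw [Ideal.height_eq_height_add_of_liesOver_of_hasGoingDown p (p.map (C : A →+* A[X]))]
  exact le_self_add

variable {k A : Type u} [Field k] [CommRing A] [Algebra k A]

theorem trdeg_quotient_add_one_le_trdeg_quotient_map_C (p : Ideal A) [p.IsPrime] :
    Algebra.trdeg k (A ⧸ p) + 1 ≤ Algebra.trdeg k (A[X] ⧸ p.map C) := by
  let e : (A ⧸ p)[X] ≃ₐ[k] A[X] ⧸ p.map C :=
    AlgEquiv.ofRingEquiv (f := p.polynomialQuotientEquivQuotientPolynomial) fun c => by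
      have hc : algebraMap k (A ⧸ p)[X] c = (algebraMap k A[X] c).map (Ideal.Quotient.mk p) := by
        rw [Polynomial.algebraMap_apply, Polynomial.algebraMap_apply, Polynomial.map_C]
        rfl
      rw [hc, Ideal.polynomialQuotientEquivQuotientPolynomial_map_mk]
      rfl
  rw [← e.trdeg_eq, ← Polynomial.trdeg_of_isDomain (R := A ⧸ p)]
  exact trdeg_add_le

theorem trdeg_quotient_comap_C_le (P : Ideal A[X]) :
    Algebra.trdeg k (A ⧸ P.comap (C : A →+* A[X])) ≤ Algebra.trdeg k (A[X] ⧸ P) :=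
  trdeg_le_of_injective
    (Ideal.quotientMapₐ P ((Algebra.ofId A A[X]).restrictScalars k) le_rfl)
    (Ideal.quotientMap_injective' (H := le_rfl) le_rfl)

theorem height_comap_C_add_trdeg_add_one_le [IsNoetherianRing A] (P : Ideal A[X]) [P.IsPrime] :
    (P.comap C).height + Cardinal.toENat (Algebra.trdeg k (A ⧸ P.comap (C : A →+* A[X]))) + 1 ≤
      P.height + Cardinal.toENat (Algebra.trdeg k (A[X] ⧸ P)) := by
  set p := P.comap (C : A →+* A[X])
  have hht := height_le_height_map_C p
  rcases (Ideal.map_comap_le : p.map C ≤ P).eq_or_lt with heq | hlt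
  · rw [← heq, add_assoc]
    gcongr
    simpa using Cardinal.toENat.monotone' (trdeg_quotient_add_one_le_trdeg_quotient_map_C p)
  · have : (p.map (C : A →+* A[X])).IsPrime := Ideal.isPrime_map_C_of_isPrime
    rw [add_right_comm]
    gcongr
    · exact (add_le_add_left hht 1).trans (Ideal.height_add_one_le_of_lt_of_isPrime hlt)
    · exact trdeg_quotient_comap_C_le P

theorem natCast_le_height_add_trdeg_quotient (k : Type u) [Field k] {n : ℕ}
    (P : Ideal (MvPolynomial (Fin n) k)) [P.IsPrime] :
    (n : ℕ∞) ≤ P.height + Cardinal.toENat (Algebra.trdeg k (MvPolynomial (Fin n) k ⧸ P)) := by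
  induction n with
  | zero => simp
  | succ n ih =>
    let e := MvPolynomial.finSuccEquiv k n
    let Q : Ideal (MvPolynomial (Fin n) k)[X] := P.comap (e.symm : _ →+* _)
    have hheight : Q.height = P.height := RingEquiv.height_comap e.symm.toRingEquiv P
    have htrdeg : Algebra.trdeg k (_ ⧸ Q) = Algebra.trdeg k (_ ⧸ P) :=
      (Ideal.quotientEquivAlg Q P e.symm
        (Ideal.map_comap_of_surjective _ e.symm.surjective P).symm).trdeg_eq
    calc ((n + 1 : ℕ) : ℕ∞) = n + 1 := by push_cast; rfl
      _ ≤ (Q.comap C).height + Cardinal.toENat (Algebra.trdeg k (_ ⧸ Q.comap C)) + 1 := by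
        gcongr
        exact ih _
      _ ≤ Q.height + Cardinal.toENat (Algebra.trdeg k (_ ⧸ Q)) :=
        height_comap_C_add_trdeg_add_one_le Q
      _ = P.height + Cardinal.toENat (Algebra.trdeg k (_ ⧸ P)) := by rw [hheight, htrdeg]

theorem height_add_ringKrullDim_quotient_mvPolynomial {k : Type u} [Field k] {n : ℕ}
    (P : Ideal (MvPolynomial (Fin n) k)) [P.IsPrime] :
    (P.height : WithBot ℕ∞) + ringKrullDim (MvPolynomial (Fin n) k ⧸ P) = n := by
  refine le_antisymm ?_ ?_
  · refine (height_add_ringKrullDim_quotient_le P).trans_eq ?_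
    rw [MvPolynomial.ringKrullDim_of_isNoetherianRing, ringKrullDim_eq_zero_of_field, zero_add,
      Nat.card_fin]
  · refine le_trans ?_ (add_le_add_right (toENat_trdeg_le_ringKrullDim k _) _)
    exact_mod_cast WithBot.coe_le_coe.2 (natCast_le_height_add_trdeg_quotient k P)

theorem height_eq_of_ringKrullDim_quotient_eq {k : Type u} [Field k] {n : ℕ}
    (P Q : Ideal (MvPolynomial (Fin n) k)) [P.IsPrime] [Q.IsPrime]
    (h : ringKrullDim (MvPolynomial (Fin n) k ⧸ P) = ringKrullDim (MvPolynomial (Fin n) k ⧸ Q)) :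
    P.height = Q.height := by
  have hP := height_add_ringKrullDim_quotient_mvPolynomial P
  have hQ := height_add_ringKrullDim_quotient_mvPolynomial Q
  rw [h] at hP
  generalize ringKrullDim (MvPolynomial (Fin n) k ⧸ Q) = D at hP hQ
  cases D with
  | bot => simp at hP
  | coe D =>
    norm_cast at hP hQ
    have hD : D ≠ ⊤ := fun h => by simp [h] at hP
    exact ENat.add_left_injective_of_ne_top hD (hP.trans hQ.symm)

end Height

/-! ### Saturation -/

section Saturation

variable {R A B C : Type*} [CommRing R] [AddCommGroup A] [Module R A] [AddCommGroup B] [Module R B]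
  [AddCommGroup C] [Module R C]

/-- The saturation of a submodule `N` with respect to a multiplicative set `T`: the elements whose
images in the localization at `T` lie in the localization of `N`. -/
def saturation (T : Submonoid R) (N : Submodule R A) : Submodule R A where
  carrier := {x | ∃ t ∈ T, t • x ∈ N}
  zero_mem' := ⟨1, one_mem _, by simp⟩
  add_mem' := by
    rintro x y ⟨s, hs, hx⟩ ⟨t, ht, hy⟩
    refine ⟨s * t, mul_mem hs ht, ?_⟩
    rw [smul_add, mul_smul s t y, mul_comm, mul_smul t s x]
    exact add_mem (N.smul_mem t hx) (N.smul_mem s hy)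
  smul_mem' := by
    rintro c x ⟨t, ht, hx⟩
    exact ⟨t, ht, smul_comm t c x ▸ N.smul_mem c hx⟩

variable {T : Submonoid R} {N : Submodule R A} {x : A}

theorem mem_saturation : x ∈ saturation T N ↔ ∃ t ∈ T, t • x ∈ N := Iff.rfl

theorem le_saturation (T : Submonoid R) (N : Submodule R A) : N ≤ saturation T N :=
  fun x hx => ⟨1, one_mem T, (one_smul R x).symm ▸ hx⟩

theorem smul_mem_saturation_iff {t : R} (ht : t ∈ T) :
    t • x ∈ saturation T N ↔ x ∈ saturation T N :=
  ⟨fun ⟨s, hs, h⟩ => ⟨s * t, mul_mem hs ht, mul_smul s t x ▸ h⟩, Submodule.smul_mem _ t⟩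

theorem saturation_mono_left {T' : Submonoid R} (h : T ≤ T') : saturation T N ≤ saturation T' N :=
  fun _ ⟨t, ht, hx⟩ => ⟨t, h ht, hx⟩

theorem le_primeCompl_of_saturation_colon_eq {P : Ideal R} [hP : P.IsPrime]
    (h : (saturation T N).colon {x} = P) : T ≤ P.primeCompl := by
  intro t ht htP
  rw [SetLike.mem_coe, ← h, Submodule.mem_colon_singleton, smul_mem_saturation_iff ht] at htP
  refine hP.ne_top (h ▸ (Submodule.colon_eq_top_iff_subset _).2 ?_)
  exact Set.singleton_subset_iff.2 htP

theorem saturation_primeCompl_colon_eq {P : Ideal R} [hP : P.IsPrime]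
    (h : (saturation T N).colon {x} = P) : (saturation P.primeCompl N).colon {x} = P := by
  refine le_antisymm ?_ ?_
  · intro f hf
    obtain ⟨g, hg, hgf⟩ := mem_saturation.1 (Submodule.mem_colon_singleton.1 hf)
    refine (hP.mem_or_mem (?_ : g * f ∈ P)).resolve_left hg
    rw [← h, Submodule.mem_colon_singleton]
    exact ⟨1, one_mem T, by rwa [one_smul, mul_smul]⟩
  · conv_lhs => rw [← h]
    exact Submodule.colon_mono
      (saturation_mono_left (le_primeCompl_of_saturation_colon_eq h)) subset_rfl

theorem mk_mem_range_localizedModule_map_iff {f : A →ₗ[R] B} {y : B} {s : T} :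
    LocalizedModule.mk y s ∈ LinearMap.range (LocalizedModule.map T f) ↔
      y ∈ saturation T (LinearMap.range f) := by
  constructor
  · rintro ⟨z, hz⟩
    induction z using LocalizedModule.induction_on with | h x t
    rw [LocalizedModule.map_mk, LocalizedModule.mk_eq] at hz
    obtain ⟨u, hu⟩ := hz
    refine ⟨u * t, (u * t).2, (u * s : T) • x, ?_⟩
    simpa only [Submonoid.smul_def, Submonoid.coe_mul, mul_smul, map_smul] using hu
  · rintro ⟨t, ht, x, hx⟩
    exact ⟨LocalizedModule.mk x (⟨t, ht⟩ * s), by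
      rw [LocalizedModule.map_mk, hx]
      exact LocalizedModule.mk_cancel_common_left ⟨t, ht⟩ s y⟩

theorem exact_localizedModule_map {f : A →ₗ[R] B} {g : B →ₗ[R] C} (hgf : g ∘ₗ f = 0)
    (h : LinearMap.ker g ≤ saturation T (LinearMap.range f)) :
    Function.Exact (LocalizedModule.map T f) (LocalizedModule.map T g) := by
  refine LinearMap.exact_of_comp_of_mem_range ?_ fun z hz => ?_
  · ext z
    induction z using LocalizedModule.induction_on with | h x t
    rw [LinearMap.comp_apply, LocalizedModule.map_mk, LocalizedModule.map_mk,
      ← LinearMap.comp_apply, hgf, LinearMap.zero_apply, LocalizedModule.zero_mk,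
      LinearMap.zero_apply]
  · induction z using LocalizedModule.induction_on with | h y s
    rw [LocalizedModule.map_mk] at hz
    obtain ⟨t, ht⟩ := LocalizedModule.mk_eq.1 (hz.trans (LocalizedModule.zero_mk 1).symm)
    rw [mk_mem_range_localizedModule_map_iff, ← smul_mem_saturation_iff t.2]
    refine h (LinearMap.mem_ker.2 ?_)
    simpa [Submonoid.smul_def] using ht

end Saturation

/-! ### Exact complexes -/

theorem exact_of_forall_exact {ι A B C : Type*} {A' B' C' : ι → Type*} [Zero C]
    [∀ i, Zero (C' i)] {f : A → B} {g : B → C} {f' : ∀ i, A' i → B' i} {g' : ∀ i, B' i → C' i}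
    {α : ∀ i, A → A' i} {β : ∀ i, B → B' i} {γ : ∀ i, C → C' i}
    (hα : Function.Surjective fun x i => α i x) (hβ : Function.Injective fun y i => β i y)
    (hγ : Function.Injective fun z i => γ i z) (hγ0 : ∀ i, γ i 0 = 0)
    (hf : ∀ i x, β i (f x) = f' i (α i x)) (hg : ∀ i y, γ i (g y) = g' i (β i y))
    (h : ∀ i, Function.Exact (f' i) (g' i)) : Function.Exact f g := by
  intro y
  have hker : g y = 0 ↔ ∀ i, g' i (β i y) = 0 := by
    simp only [← hg]
    exact ⟨fun hy i => by rw [hy, hγ0], fun hy => hγ (funext fun i => (hy i).trans (hγ0 i).symm)⟩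
  have hrange : y ∈ Set.range f ↔ ∀ i, β i y ∈ Set.range (f' i) := by
    refine ⟨fun ⟨x, hx⟩ i => ⟨α i x, by rw [← hf, hx]⟩, fun hy => ?_⟩
    choose x' hx' using hy
    obtain ⟨x, rfl⟩ := hα x'
    exact ⟨x, hβ (funext fun i => (hf i x).trans (hx' i))⟩
  rw [hker, hrange]
  exact forall_congr' fun i => h i _

theorem smul_mk_mem_range_quotSMulTop_map_iff {R : Type*} [CommRing R] {A B C : Type*}
    [AddCommGroup A] [AddCommGroup B] [AddCommGroup C] [Module R A] [Module R B] [Module R C]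
    {f : A →ₗ[R] B} {g : B →ₗ[R] C} (hfg : Function.Exact f g) {r : R} (hr : IsSMulRegular C r)
    {b : B} {c : C} (hb : g b = r • c) (s : R) :
    s • (Submodule.Quotient.mk b : QuotSMulTop r B) ∈ LinearMap.range (QuotSMulTop.map r f) ↔
      s • c ∈ LinearMap.range g := by
  constructor
  · rintro ⟨y, hy⟩
    obtain ⟨y, rfl⟩ := Submodule.mkQ_surjective _ y
    obtain ⟨z, -, hz : r • z = f y - s • b⟩ :=
      (Submodule.mem_smul_pointwise_iff_exists _ _ _).1 ((Submodule.Quotient.eq _).1 hy)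
    refine ⟨-z, hr ?_⟩
    have hgz := congrArg g hz
    rw [map_smul, map_sub, map_smul, hfg.apply_apply_eq_zero, zero_sub, hb] at hgz
    simp only [map_neg, smul_neg, hgz, neg_neg, smul_comm s r]
  · rintro ⟨t, ht⟩
    obtain ⟨y, hy⟩ := (hfg (s • b - r • t)).1 (by
      rw [map_sub, map_smul, map_smul, hb, ht, smul_comm, sub_self])
    refine ⟨Submodule.Quotient.mk y, (Submodule.Quotient.eq _).2 ?_⟩
    refine (Submodule.mem_smul_pointwise_iff_exists _ _ _).2 ⟨-t, trivial, ?_⟩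
    change r • -t = f y - s • b
    rw [hy, smul_neg, sub_sub_cancel_left]

open RingTheory.Sequence in
theorem length_le_of_exact_of_isWeaklyRegular {R : Type*} [CommRing R] {rs : List R} {L : ℕ}
    {G : ℕ → Type*} [∀ i, AddCommGroup (G i)] [∀ i, Module R (G i)] {d : ∀ i, G (i + 1) →ₗ[R] G i}
    (hL : ∀ i, L < i → Subsingleton (G i)) (hd : ∀ i, Function.Exact (d (i + 1)) (d i))
    (hreg : ∀ i, IsWeaklyRegular (G i) rs) {g : G 0} (hg : g ∉ LinearMap.range (d 0))
    (hrs : ∀ r ∈ rs, r • g ∈ LinearMap.range (d 0)) : rs.length ≤ L := by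
  induction rs generalizing L G with
  | nil => exact Nat.zero_le L
  | cons r rs ih =>
    obtain ⟨hrg, hrs⟩ := List.forall_mem_cons.1 hrs
    have hr : ∀ i, IsSMulRegular (G i) r := fun i => ((isWeaklyRegular_cons_iff _ _ _).1 (hreg i)).1
    obtain ⟨h, hh⟩ := hrg
    have hrange := smul_mk_mem_range_quotSMulTop_map_iff (hd 0) (hr 0) hh
    cases L with
    | zero =>
      have := hL 1 one_pos
      rw [Subsingleton.elim h 0, map_zero] at hh
      exact absurd ((hr 0).right_eq_zero_of_smul hh.symm ▸ zero_mem _) hg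
    | succ L =>
      refine Nat.succ_le_succ (ih (G := fun i => QuotSMulTop r (G (i + 1)))
        (d := fun i => QuotSMulTop.map r (d (i + 1))) (g := Submodule.Quotient.mk h)
        (fun i hi => ?_) (fun i => ?_) (fun i => ?_) ?_ fun s hs => (hrange s).2 (hrs s hs))
      · have := hL (i + 1) (by omega)
        exact (Submodule.mkQ_surjective _).subsingleton
      · exact QuotSMulTop.map_first_exact_on_four_term_exact_of_isSMulRegular_last
          (hd (i + 1)) (hd i) (hr i)
      · exact ((isWeaklyRegular_cons_iff _ _ _).1 (hreg (i + 1))).2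
      · intro hmem
        exact hg (by simpa only [one_smul] using (hrange 1).1 (by simpa only [one_smul] using hmem))

theorem height_le_of_flat_complex {R : Type*} [CommRing R] [IsRegularRing R] {P : Ideal R}
    [P.IsPrime] {L : ℕ} {G : ℕ → Type*} [∀ i, AddCommGroup (G i)] [∀ i, Module R (G i)]
    [∀ i, Module.Flat R (G i)] {d : ∀ i, G (i + 1) →ₗ[R] G i}
    (hL : ∀ i, L < i → Subsingleton (G i)) (hd : ∀ i, d i ∘ₗ d (i + 1) = 0)
    (hex : ∀ i, LinearMap.ker (d i) ≤ saturation P.primeCompl (LinearMap.range (d (i + 1))))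
    {g : G 0} (hg : (saturation P.primeCompl (LinearMap.range (d 0))).colon {g} = P) :
    P.height ≤ L := by
  obtain ⟨rs, hlen, hmem, hreg⟩ :=
    exists_isWeaklyRegular_of_isRegularLocalRing (Localization.AtPrime P)
  have hheight : P.height = rs.length := by
    have hdim : (IsLocalRing.maximalIdeal (Localization.AtPrime P)).spanFinrank = ringKrullDim _ :=
      IsRegularLocalRing.spanFinrank_maximalIdeal
    rw [IsLocalization.AtPrime.ringKrullDim_eq_height P, ← hlen] at hdim
    exact_mod_cast hdim.symm
  rw [hheight, Nat.cast_le]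
  refine length_le_of_exact_of_isWeaklyRegular
    (G := fun i => LocalizedModule P.primeCompl (G i))
    (d := fun i => LocalizedModule.map P.primeCompl (d i)) (g := LocalizedModule.mk g 1)
    (fun i hi => ?_) (fun i => exact_localizedModule_map (hd i) (hex i)) (fun i => ?_) ?_
    fun r hr => ?_
  · have := hL i hi
    infer_instance
  · have : Module.Flat (Localization.AtPrime P) (LocalizedModule P.primeCompl (G i)) :=
      inferInstanceAs (Module.Flat (Localization P.primeCompl) _)
    exact ((TensorProduct.rid (Localization.AtPrime P) _).isWeaklyRegular_congr rs).1
      hreg.isWeaklyRegular_lTensor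
  · rw [mk_mem_range_localizedModule_map_iff]
    intro hg'
    refine Ideal.IsPrime.ne_top ‹P.IsPrime› (hg ▸ (Submodule.colon_eq_top_iff_subset _).2 ?_)
    exact Set.singleton_subset_iff.2 hg'
  · obtain ⟨⟨p, s⟩, rfl⟩ := IsLocalization.mk'_surjective P.primeCompl r
    have hp : p ∈ P := (IsLocalization.AtPrime.mk'_mem_maximal_iff _ P p s).1 (hmem _ hr)
    rw [← Localization.mk_eq_mk', LocalizedModule.mk_smul_mk, mk_mem_range_localizedModule_map_iff]
    exact Submodule.mem_colon_singleton.1 (hg.ge hp)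

/-! ### Homogeneous primes -/

section HomogeneousPrimes

theorem exists_linearOrder_isOrderedCancelAddMonoid (ι : Type*) [AddCommGroup ι]
    [D : DecidableEq ι] [Module.Finite ℤ ι] [Module.IsTorsionFree ℤ ι] :
    ∃ o : LinearOrder ι, o.toDecidableEq = D ∧ IsOrderedCancelAddMonoid ι := by
  let b := Module.finBasis ℤ ι
  let f : ι → Lex (Fin (Module.finrank ℤ ι) → ℤ) := fun x => toLex (b.equivFun x)
  let o : LinearOrder ι := LinearOrder.lift' f b.equivFun.injective
  exact ⟨o, Subsingleton.elim _ _,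
    Function.Injective.isOrderedCancelAddMonoid f (map_add b.equivFun) Iff.rfl⟩

variable {ι R A : Type*} [AddCommGroup ι] [DecidableEq ι] [Module.Finite ℤ ι]
  [Module.IsTorsionFree ℤ ι] [CommRing R] [CommRing A] [Algebra R A] (𝒜 : ι → Submodule R A)
  [GradedRing 𝒜]

theorem isPrime_homogeneousCore {Q : Ideal A} (hQ : Q.IsPrime) :
    (Q.homogeneousCore 𝒜).toIdeal.IsPrime := by
  obtain ⟨o, rfl, hc⟩ := exists_linearOrder_isOrderedCancelAddMonoid ι
  exact hQ.homogeneousCore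

variable {𝒜}

theorem exists_isHomogeneous_isPrime_le {I : Ideal A} (hI : I.IsHomogeneous 𝒜) {Q : Ideal A}
    (hQ : Q.IsPrime) (hIQ : I ≤ Q) :
    ∃ P : Ideal A, P.IsPrime ∧ P.IsHomogeneous 𝒜 ∧ I ≤ P ∧ P ≤ Q :=
  ⟨_, isPrime_homogeneousCore 𝒜 hQ, HomogeneousIdeal.isHomogeneous _,
    hI.toIdeal_homogeneousCore_eq_self.symm.trans_le (Ideal.homogeneousCore_mono 𝒜 hIQ),
    Ideal.toIdeal_homogeneousCore_le 𝒜 Q⟩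

theorem isHomogeneous_of_mem_minimalPrimes {I P : Ideal A} (hI : I.IsHomogeneous 𝒜)
    (hP : P ∈ I.minimalPrimes) : P.IsHomogeneous 𝒜 := by
  obtain ⟨P', hP', hP'h, hIP', hP'P⟩ := exists_isHomogeneous_isPrime_le hI hP.1.1 hP.1.2
  rwa [← hP'P.antisymm (hP.2 ⟨hP', hIP'⟩ hP'P)]

end HomogeneousPrimes

/-! ### Homogeneous submodules -/

section HomogeneousSubmodules

open DirectSum

section Decomposition

variable {ι A M N σM σN : Type*} [DecidableEq ι] [Semiring A] [AddCommMonoid M] [Module A M]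
  [AddCommMonoid N] [Module A N] [SetLike σM M] [AddSubmonoidClass σM M] [SetLike σN N]
  [AddSubmonoidClass σN N] {ℳ : ι → σM} {𝒩 : ι → σN} [Decomposition ℳ] [Decomposition 𝒩]

theorem isHomogeneous_bot : (⊥ : Submodule A M).IsHomogeneous ℳ := by
  rintro i x (rfl : x = 0)
  simp

theorem isHomogeneous_sup {P Q : Submodule A M} (hP : P.IsHomogeneous ℳ)
    (hQ : Q.IsHomogeneous ℳ) : (P ⊔ Q).IsHomogeneous ℳ := by
  intro i x hx
  obtain ⟨y, hy, z, hz, rfl⟩ := Submodule.mem_sup.1 hx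
  rw [decompose_add]
  exact Submodule.add_mem_sup (hP i hy) (hQ i hz)

theorem exists_homogeneous_add_eq_of_mem_sup {P Q : Submodule A M} (hP : P.IsHomogeneous ℳ)
    (hQ : Q.IsHomogeneous ℳ) {i : ι} {x : M} (hx : x ∈ ℳ i) (h : x ∈ P ⊔ Q) :
    ∃ y ∈ P, ∃ z ∈ Q, y ∈ ℳ i ∧ z ∈ ℳ i ∧ y + z = x := by
  obtain ⟨y, hy, z, hz, rfl⟩ := Submodule.mem_sup.1 h
  refine ⟨_, hP i hy, _, hQ i hz, SetLike.coe_mem _, SetLike.coe_mem _, ?_⟩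
  rw [← AddMemClass.coe_add, ← DirectSum.add_apply, ← decompose_add, decompose_of_mem_same ℳ hx]

theorem isHomogeneous_iInf {κ : Sort*} {P : κ → Submodule A M}
    (hP : ∀ j, (P j).IsHomogeneous ℳ) : (⨅ j, P j).IsHomogeneous ℳ := by
  intro i x hx
  simp only [Submodule.mem_iInf] at hx ⊢
  exact fun j => hP j i (hx j)

theorem decompose_map_of_mem {f : M →ₗ[A] N} (hf : ∀ i, ∀ x ∈ ℳ i, f x ∈ 𝒩 i) (x : M) (i : ι) :
    (decompose 𝒩 (f x) i : N) = f (decompose ℳ x i) := by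
  induction x using Decomposition.inductionOn ℳ with
  | zero => simp
  | @homogeneous j x =>
    obtain rfl | h := eq_or_ne j i
    · rw [decompose_of_mem_same 𝒩 (hf j x x.2), decompose_of_mem_same ℳ x.2]
    · rw [decompose_of_mem_ne 𝒩 (hf j x x.2) h, decompose_of_mem_ne ℳ x.2 h, map_zero]
  | add x y hx hy => simp [hx, hy]

theorem isHomogeneous_range {f : M →ₗ[A] N} (hf : ∀ i, ∀ x ∈ ℳ i, f x ∈ 𝒩 i) :
    (LinearMap.range f).IsHomogeneous 𝒩 := by
  rintro i _ ⟨x, rfl⟩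
  exact ⟨_, (decompose_map_of_mem hf x i).symm⟩

theorem isHomogeneous_ker {f : M →ₗ[A] N} (hf : ∀ i, ∀ x ∈ ℳ i, f x ∈ 𝒩 i) :
    (LinearMap.ker f).IsHomogeneous ℳ := by
  intro i x hx
  rw [LinearMap.mem_ker] at hx ⊢
  rw [← decompose_map_of_mem hf, hx, decompose_zero, DirectSum.zero_apply, ZeroMemClass.coe_zero]

theorem isHomogeneous_le_iff {P Q : Submodule A M} (hP : P.IsHomogeneous ℳ) :
    P ≤ Q ↔ ∀ i, ∀ x ∈ ℳ i, x ∈ P → x ∈ Q := by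
  classical
  refine ⟨fun h i x _ hx => h hx, fun h x hx => ?_⟩
  rw [← sum_support_decompose ℳ x]
  exact sum_mem fun i _ => h i _ (SetLike.coe_mem _) (hP i hx)

end Decomposition

theorem exists_colon_decompose_le {ι A M σM : Type*} [DecidableEq ι] [CommRing A]
    [AddCommGroup M] [Module A M] [SetLike σM M] [AddSubmonoidClass σM M] (ℳ : ι → σM)
    [Decomposition ℳ] {N : Submodule A M} {P : Ideal A} [P.IsPrime] {x : M}
    (h : N.colon {x} ≤ P) : ∃ i, N.colon {(decompose ℳ x i : M)} ≤ P := by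
  classical
  have hinf : (DFinsupp.support (decompose ℳ x)).inf
      (fun i => N.colon {(decompose ℳ x i : M)}) ≤ P := fun f hf => by
    refine h (Submodule.mem_colon_singleton.2 ?_)
    rw [← sum_support_decompose ℳ x, Finset.smul_sum]
    exact sum_mem fun i hi => Submodule.mem_colon_singleton.1 (Submodule.mem_finsetInf.1 hf i hi)
  obtain ⟨i, -, hi⟩ := (Ideal.IsPrime.inf_le' inferInstance).1 hinf
  exact ⟨i, hi⟩

variable {ι A M σA σM : Type*} [AddCommGroup ι] [DecidableEq ι] [CommRing A] [AddCommGroup M]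
  [Module A M] [SetLike σA A] [SetLike σM M] [AddSubgroupClass σM M] {𝒜 : ι → σA} {ℳ : ι → σM}
  [Decomposition ℳ] [SetLike.GradedSMul 𝒜 ℳ]

theorem decompose_smul_of_left_mem {d : ι} {f : A} (hf : f ∈ 𝒜 d) (x : M) (e : ι) :
    (decompose ℳ (f • x) (d + e) : M) = f • (decompose ℳ x e : M) := by
  induction x using Decomposition.inductionOn ℳ with
  | zero => simp
  | @homogeneous a x =>
    have hfx : f • (x : M) ∈ ℳ (d + a) := SetLike.GradedSMul.smul_mem hf x.2
    obtain rfl | h := eq_or_ne a e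
    · rw [decompose_of_mem_same ℳ x.2, decompose_of_mem_same ℳ hfx]
    · rw [decompose_of_mem_ne ℳ x.2 h, smul_zero,
        decompose_of_mem_ne ℳ hfx fun h' => h (add_left_cancel h')]
  | add x y hx hy => simp [smul_add, hx, hy]

theorem isHomogeneous_saturation {N : Submodule A M} (hN : N.IsHomogeneous ℳ) {T : Submonoid A}
    (hT : ∀ t ∈ T, SetLike.IsHomogeneousElem 𝒜 t) : (saturation T N).IsHomogeneous ℳ := by
  rintro i x ⟨t, ht, hx⟩
  obtain ⟨d, hd⟩ := hT t ht
  exact ⟨t, ht, decompose_smul_of_left_mem (ℳ := ℳ) hd x i ▸ hN _ hx⟩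

variable [AddSubgroupClass σA A] [GradedRing 𝒜]

theorem decompose_smul_of_right_mem {e : ι} {x : M} (hx : x ∈ ℳ e) (f : A) (d : ι) :
    (decompose ℳ (f • x) (d + e) : M) = (decompose 𝒜 f d : A) • x := by
  induction f using Decomposition.inductionOn 𝒜 with
  | zero => simp
  | @homogeneous a f =>
    have hfx : (f : A) • x ∈ ℳ (a + e) := SetLike.GradedSMul.smul_mem f.2 hx
    obtain rfl | h := eq_or_ne a d
    · rw [decompose_of_mem_same 𝒜 f.2, decompose_of_mem_same ℳ hfx]
    · rw [decompose_of_mem_ne 𝒜 f.2 h, zero_smul,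
        decompose_of_mem_ne ℳ hfx fun h' => h (add_right_cancel h')]
  | add f g hf hg => simp [add_smul, hf, hg]

theorem isHomogeneous_colon_singleton {N : Submodule A M} (hN : N.IsHomogeneous ℳ) {d : ι} {x : M}
    (hx : x ∈ ℳ d) : (N.colon {x}).IsHomogeneous 𝒜 := by
  intro i f hf
  rw [Submodule.mem_colon_singleton] at hf ⊢
  rw [← decompose_smul_of_right_mem hx]
  exact hN _ hf

end HomogeneousSubmodules

section HomogeneousAssociatedPrimes

open DirectSum

variable {ι R A M σM : Type*} [AddCommGroup ι] [DecidableEq ι] [Module.Finite ℤ ι]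
  [Module.IsTorsionFree ℤ ι] [CommRing R] [CommRing A] [IsNoetherianRing A] [Algebra R A]
  [AddCommGroup M] [Module A M] [SetLike σM M] [AddSubgroupClass σM M] {ℳ : ι → σM}
  [Decomposition ℳ]

theorem exists_homogeneous_colon_eq_of_mem_minimalPrimes (𝒜 : ι → Submodule R A) [GradedRing 𝒜]
    [SetLike.GradedSMul 𝒜 ℳ] {N : Submodule A M} (hN : N.IsHomogeneous ℳ) {d : ι} {x : M}
    (hx : x ∈ ℳ d) {P : Ideal A} (hP : P ∈ (N.colon {x}).minimalPrimes) :
    ∃ e, ∃ z ∈ ℳ e, N.colon {z} = P := by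
  have hPprime : P.IsPrime := hP.1.1
  have hPhom : P.IsHomogeneous 𝒜 :=
    isHomogeneous_of_mem_minimalPrimes (isHomogeneous_colon_singleton hN hx) hP
  obtain ⟨f, hf⟩ : ∃ f : A, N.colon {f • x} = P := by
    have hass : P ∈ associatedPrimes A (A ⧸ N.colon {x}) :=
      Module.associatedPrimes.minimalPrimes_annihilator_subset_associatedPrimes _ _ <| by
        rwa [Ideal.annihilator_quotient]
    obtain ⟨-, f, hf⟩ := isAssociatedPrime_iff.1 hass
    obtain ⟨f, rfl⟩ := Ideal.Quotient.mk_surjective f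
    refine ⟨f, hf ▸ ?_⟩
    ext g
    rw [Submodule.mem_colon_singleton, Submodule.mem_colon_singleton, Submodule.mem_bot,
      ← mul_smul, ← Submodule.mem_colon_singleton, ← Ideal.Quotient.eq_zero_iff_mem, map_mul]
    rfl
  obtain ⟨e, he⟩ := exists_colon_decompose_le ℳ hf.le
  refine ⟨e, _, SetLike.coe_mem _, he.antisymm <|
    (isHomogeneous_le_iff hPhom).2 fun i g hg hgP => ?_⟩
  rw [Submodule.mem_colon_singleton, ← decompose_smul_of_left_mem hg]
  exact hN _ (Submodule.mem_colon_singleton.1 (hf.ge hgP))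

end HomogeneousAssociatedPrimes

theorem exists_forall_eq_dotProduct {ι R : Type*} [Fintype ι] [CommSemiring R]
    (φ : (ι → R) →ₗ[R] R) : ∃ m : ι → R, ∀ w, φ w = w ⬝ᵥ m := by
  classical
  exact ⟨fun i => φ fun j => if i = j then 1 else 0, φ.pi_apply_eq_sum_univ⟩

namespace SmoothProjectiveFan

variable {n r : ℕ} (X : SmoothProjectiveFan n r)

/-! ### The Picard group -/

theorem exists_dotProduct_ray_eq {σ : Finset (Fin r)} (hσ : σ ∈ X.cones) (v : Fin r → ℤ) :
    ∃ m : Fin n → ℤ, ∀ ρ ∈ σ, X.ray ρ ⬝ᵥ m = v ρ := by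
  obtain ⟨b, e, hb⟩ := X.smooth σ hσ
  obtain ⟨m, hm⟩ := exists_forall_eq_dotProduct
    (b.constr ℤ (Function.extend e (fun ρ : σ => v ρ) 0))
  refine ⟨m, fun ρ hρ => ?_⟩
  rw [← hm, ← hb ⟨ρ, hρ⟩, b.constr_basis, e.injective.extend_apply]

theorem dotProduct_eq_zero_of_mem_hull {σ : Finset (Fin r)} {m : Fin n → ℤ}
    (hm : ∀ ρ ∈ σ, X.ray ρ ⬝ᵥ m = 0) {v : Fin n → ℤ}
    (hv : (fun i => (v i : ℝ)) ∈
      PointedCone.hull ℝ ((fun ρ i => (X.ray ρ i : ℝ)) '' (σ : Set (Fin r)))) :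
    v ⬝ᵥ m = 0 := by
  let φ : (Fin n → ℝ) →ₗ[ℝ] ℝ := Fintype.linearCombination ℝ fun i => (m i : ℝ)
  have hφ (w : Fin n → ℤ) : φ (fun i => (w i : ℝ)) = (w ⬝ᵥ m : ℤ) := by
    simp [φ, Fintype.linearCombination_apply, dotProduct]
  have hker : PointedCone.hull ℝ ((fun ρ i => (X.ray ρ i : ℝ)) '' (σ : Set (Fin r))) ≤
      (LinearMap.ker φ).restrictScalars _ := by
    refine Submodule.span_le.2 ?_
    rintro _ ⟨ρ, hρ, rfl⟩
    exact (hφ _).trans (by rw [hm ρ hρ, Int.cast_zero])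
  exact_mod_cast (hφ v).symm.trans (hker hv)

theorem span_ray : Submodule.span ℤ (Set.range X.ray) = ⊤ := by
  refine eq_top_iff.2 fun v _ => ?_
  obtain ⟨σ, hσ, hv⟩ := X.complete fun i => (v i : ℝ)
  obtain ⟨b, e, hb⟩ := X.smooth σ hσ
  rw [← b.sum_repr v]
  refine sum_mem fun j _ => ?_
  by_cases hj : j ∈ Set.range e
  · obtain ⟨ρ, rfl⟩ := hj
    exact Submodule.smul_mem _ _ (hb ρ ▸ Submodule.subset_span ⟨ρ, rfl⟩)
  · have hcoord : b.repr v j = 0 := by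
      obtain ⟨m, hm⟩ := exists_forall_eq_dotProduct (b.coord j)
      rw [← b.coord_apply, hm]
      refine X.dotProduct_eq_zero_of_mem_hull (fun ρ hρ => ?_) hv
      rw [← hm, ← hb ⟨ρ, hρ⟩, b.coord_apply, b.repr_self, Finsupp.single_eq_of_ne]
      exact fun h => hj ⟨_, h.symm⟩
    rw [hcoord, zero_smul]
    exact zero_mem _

theorem pic_eq_zero_of_smul_eq_zero {c : ℤ} (hc : c ≠ 0) {x : X.Pic} (h : c • x = 0) : x = 0 := by
  obtain ⟨v, rfl⟩ := Submodule.Quotient.mk_surjective _ x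
  rw [← Submodule.Quotient.mk_smul, Submodule.Quotient.mk_eq_zero] at h
  obtain ⟨m, hm⟩ := h
  have hdvd (w : Fin n → ℤ) : c ∣ w ⬝ᵥ m := by
    have hw : w ∈ Submodule.span ℤ (Set.range X.ray) := X.span_ray ▸ Submodule.mem_top
    induction hw using Submodule.span_induction with
    | mem w hw =>
      obtain ⟨ρ, rfl⟩ := hw
      exact ⟨v ρ, congrFun hm ρ⟩
    | zero => simp
    | add x y _ _ hx hy => exact add_dotProduct x y m ▸ dvd_add hx hy
    | smul a x _ hx => exact smul_dotProduct a x m ▸ hx.mul_left a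
  choose m' hm' using fun i => hdvd (Pi.single i 1)
  simp only [single_dotProduct, one_mul] at hm'
  obtain rfl : m = c • m' := funext hm'
  rw [map_smul] at hm
  exact (Submodule.Quotient.mk_eq_zero _).2 ⟨m', smul_right_injective _ hc hm⟩

instance : Module.IsTorsionFree ℤ X.Pic := by
  rw [Module.isTorsionFree_iff_smul_eq_zero]
  exact fun c x h => or_iff_not_imp_left.2 fun hc => X.pic_eq_zero_of_smul_eq_zero hc h

theorem closure_divClass {σ : Finset (Fin r)} (hσ : σ ∈ X.cones) :
    AddSubgroup.closure {d | ∃ ρ ∉ σ, d = X.divClass ρ} = ⊤ := by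
  refine eq_top_iff.2 fun x _ => ?_
  obtain ⟨v, rfl⟩ := Submodule.Quotient.mk_surjective _ x
  obtain ⟨m, hm⟩ := X.exists_dotProduct_ray_eq hσ v
  have hv : (Submodule.Quotient.mk v : X.Pic) = ∑ ρ, (v ρ - X.ray ρ ⬝ᵥ m) • X.divClass ρ := by
    have hsum : v - Matrix.mulVecLin (Matrix.of X.ray) m =
        ∑ ρ, (v ρ - X.ray ρ ⬝ᵥ m) • (Pi.single ρ 1 : Fin r → ℤ) :=
      pi_eq_sum_univ' _
    calc (Submodule.Quotient.mk v : X.Pic)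
        = Submodule.Quotient.mk (v - Matrix.mulVecLin (Matrix.of X.ray) m) := by
          rw [Submodule.Quotient.eq, sub_sub_cancel]
          exact ⟨m, rfl⟩
      _ = _ := by
          rw [hsum, ← Submodule.mkQ_apply, map_sum]
          exact Finset.sum_congr rfl fun ρ _ => map_smul _ _ _
  rw [hv]
  refine sum_mem fun ρ _ => ?_
  by_cases hρ : ρ ∈ σ
  · rw [hm ρ hρ, sub_self, zero_smul]
    exact zero_mem _
  · have hmem : X.divClass ρ ∈ AddSubgroup.closure {d | ∃ ρ ∉ σ, d = X.divClass ρ} :=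
      AddSubgroup.subset_closure ⟨ρ, hρ, rfl⟩
    exact zsmul_mem hmem _

/-! ### Homogeneous ideals of the Cox ring -/

variable {k : Type u} [Field k]

theorem isHomogeneousElem_of_mem_chartSubmonoid {σ : Finset (Fin r)} {t : X.Cox k}
    (ht : t ∈ X.chartSubmonoid k σ) : SetLike.IsHomogeneousElem (X.coxPiece k) t := by
  have hle : X.chartSubmonoid k σ ≤ SetLike.homogeneousSubmonoid (X.coxPiece k) := by
    refine Submonoid.closure_le.2 ?_
    rintro _ ⟨ρ, -, rfl⟩
    exact ⟨_, MvPolynomial.isWeightedHomogeneous_X k X.divClass ρ⟩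
  exact hle ht

theorem exists_chartSubmonoid_degree (k : Type u) [Field k] {σ : Finset (Fin r)}
    (hσ : σ ∈ X.cones) (d : X.Pic) :
    ∃ b : X.Pic, ∃ s ∈ X.chartSubmonoid k σ, ∃ t ∈ X.chartSubmonoid k σ,
      s ∈ X.coxPiece k (b + d) ∧ t ∈ X.coxPiece k b := by
  have hd : d ∈ AddSubgroup.closure {d | ∃ ρ ∉ σ, d = X.divClass ρ} :=
    X.closure_divClass hσ ▸ AddSubgroup.mem_top d
  induction hd using AddSubgroup.closure_induction with
  | mem d hd =>
    obtain ⟨ρ, hρ, rfl⟩ := hd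
    refine ⟨0, MvPolynomial.X ρ, Submonoid.subset_closure ⟨ρ, hρ, rfl⟩, 1, one_mem _, ?_,
      SetLike.GradedOne.one_mem⟩
    rw [zero_add]
    exact MvPolynomial.isWeightedHomogeneous_X k X.divClass ρ
  | zero =>
    exact ⟨0, 1, one_mem _, 1, one_mem _, (add_zero (0 : X.Pic)).symm ▸ SetLike.GradedOne.one_mem,
      SetLike.GradedOne.one_mem⟩
  | add d e _ _ hd he =>
    obtain ⟨b, s, hs, t, ht, hsb, htb⟩ := hd
    obtain ⟨b', s', hs', t', ht', hsb', htb'⟩ := he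
    exact ⟨b + b', s * s', mul_mem hs hs', t * t', mul_mem ht ht',
      add_add_add_comm b b' d e ▸ SetLike.mul_mem_graded hsb hsb',
      SetLike.mul_mem_graded htb htb'⟩
  | neg d _ hd =>
    obtain ⟨b, s, hs, t, ht, hsb, htb⟩ := hd
    exact ⟨b + d, t, ht, s, hs, by rwa [add_neg_cancel_right], hsb⟩

theorem not_irrelevantIdeal_le {σ : Finset (Fin r)} (hσ : σ ∈ X.cones) {P : Ideal (X.Cox k)}
    [P.IsPrime] (h : X.chartSubmonoid k σ ≤ P.primeCompl) : ¬ X.irrelevantIdeal k ≤ P := by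
  intro hle
  have hprod : ∏ ρ ∈ σᶜ, (MvPolynomial.X ρ : X.Cox k) ∈ X.chartSubmonoid k σ :=
    prod_mem fun ρ hρ => Submonoid.subset_closure ⟨ρ, Finset.mem_compl.1 hρ, rfl⟩
  exact h hprod (hle (Ideal.subset_span ⟨σ, hσ, rfl⟩))

theorem exists_mem_chartSubmonoid_of_forall_point {σ : Finset (Fin r)} (hσ : σ ∈ X.cones)
    {I : Ideal (X.Cox k)} (hI : I.IsHomogeneous (X.coxPiece k))
    (h : ∀ P : X.Point k, ¬ I ≤ P.1.asIdeal) : ∃ t ∈ X.chartSubmonoid k σ, t ∈ I := by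
  by_contra! hd
  obtain ⟨Q, hQ, hIQ, hQd⟩ := Ideal.exists_le_prime_disjoint I (X.chartSubmonoid k σ)
    (Set.disjoint_right.2 hd)
  obtain ⟨P, hP, hPh, hIP, hPQ⟩ := exists_isHomogeneous_isPrime_le hI hQ hIQ
  refine h ⟨⟨P, hP⟩, hPh, X.not_irrelevantIdeal_le hσ ?_⟩ hIP
  exact fun t ht htP => Set.disjoint_left.1 hQd (hPQ htP) ht

end SmoothProjectiveFan

section GradedModules

open SmoothProjectiveFan

variable {n r : ℕ} {X : SmoothProjectiveFan n r} {k : Type u} [Field k] {σ : Finset (Fin r)}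

namespace GradedModule

variable {M : GradedModule.{u, v} X k} {N : GradedModule.{u, w} X k} {K : GradedModule.{u, u} X k}

/-! ### Sections over the charts -/

noncomputable instance (M : GradedModule.{u, v} X k) : DirectSum.Decomposition M.piece :=
  M.isInternal.chooseDecomposition

instance (M : GradedModule.{u, v} X k) : SetLike.GradedSMul (X.coxPiece k) M.piece :=
  ⟨fun _ _ _ _ hf hm => M.smul_mem hf hm⟩

theorem isHomogeneous_saturation_chartSubmonoid {V : Submodule (X.Cox k) M.carrier}
    (hV : V.IsHomogeneous M.piece) :
    (saturation (X.chartSubmonoid k σ) V).IsHomogeneous M.piece :=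
  isHomogeneous_saturation hV fun _ => X.isHomogeneousElem_of_mem_chartSubmonoid

theorem Hom.isHomogeneous_range (f : M.Hom N) :
    (LinearMap.range f.toLinearMap).IsHomogeneous N.piece :=
  _root_.isHomogeneous_range (ℳ := M.piece) fun _ _ hx => f.map_mem hx

theorem Hom.isHomogeneous_ker (f : M.Hom N) :
    (LinearMap.ker f.toLinearMap).IsHomogeneous M.piece :=
  _root_.isHomogeneous_ker (𝒩 := N.piece) fun _ _ hx => f.map_mem hx

/-- The section `m / s` over `U_σ`, for homogeneous elements `m` and `s` of the same degree. -/
noncomputable def chartMk (M : GradedModule.{u, v} X k) {d : X.Pic} {m : M.carrier} {s : X.Cox k}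
    (hm : m ∈ M.piece d) (hs : s ∈ X.chartSubmonoid k σ) (hsd : s ∈ X.coxPiece k d) : M.chart σ :=
  ⟨LocalizedModule.mk m ⟨s, hs⟩, d, m, ⟨s, hs⟩, hm, hsd, rfl⟩

/-- The function `f / s` on `U_σ`, for homogeneous elements `f` and `s` of the same degree. -/
noncomputable def chartRingMk {d : X.Pic} {f s : X.Cox k} (hf : f ∈ X.coxPiece k d)
    (hs : s ∈ X.chartSubmonoid k σ) (hsd : s ∈ X.coxPiece k d) : X.chartRing k σ :=
  HomogeneousLocalization.mk ⟨d, ⟨f, hf⟩, ⟨s, hsd⟩, hs⟩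

theorem exists_eq_chartMk (y : M.chart σ) : ∃ (d : X.Pic) (m : M.carrier) (s : X.Cox k)
    (hm : m ∈ M.piece d) (hs : s ∈ X.chartSubmonoid k σ) (hsd : s ∈ X.coxPiece k d),
    y = M.chartMk hm hs hsd := by
  obtain ⟨_, d, m, s, hm, hs, rfl⟩ := y
  exact ⟨d, m, s, hm, s.2, hs, rfl⟩

variable {d e : X.Pic} {m m' : M.carrier} {s s' : X.Cox k}

theorem chartMk_eq_iff (hm : m ∈ M.piece d) (hs : s ∈ X.chartSubmonoid k σ)
    (hsd : s ∈ X.coxPiece k d) (hm' : m' ∈ M.piece e) (hs' : s' ∈ X.chartSubmonoid k σ)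
    (hse : s' ∈ X.coxPiece k e) :
    M.chartMk hm hs hsd = M.chartMk hm' hs' hse ↔
      ∃ t ∈ X.chartSubmonoid k σ, t • s' • m = t • s • m' := by
  refine (Subtype.ext_iff.trans LocalizedModule.mk_eq).trans ?_
  exact ⟨fun ⟨t, ht⟩ => ⟨t, t.2, ht⟩, fun ⟨t, ht, h⟩ => ⟨⟨t, ht⟩, h⟩⟩

theorem chartMk_eq_zero_iff (hm : m ∈ M.piece d) (hs : s ∈ X.chartSubmonoid k σ)
    (hsd : s ∈ X.coxPiece k d) :
    M.chartMk hm hs hsd = 0 ↔ m ∈ saturation (X.chartSubmonoid k σ) ⊥ := by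
  have h0 : M.chartMk (zero_mem (M.piece d)) hs hsd = 0 :=
    Subtype.ext (LocalizedModule.zero_mk _)
  rw [← h0, chartMk_eq_iff, ← smul_mem_saturation_iff hs]
  simp [mem_saturation]

theorem Hom.chart_chartMk (f : M.Hom N) (hm : m ∈ M.piece d) (hs : s ∈ X.chartSubmonoid k σ)
    (hsd : s ∈ X.coxPiece k d) :
    f.chart σ (M.chartMk hm hs hsd) = N.chartMk (f.map_mem hm) hs hsd :=
  Subtype.ext (LocalizedModule.map_mk _ _ _ _)

theorem res_chartMk {τ : Finset (Fin r)} (h : τ ⊆ σ) (hm : m ∈ M.piece d)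
    (hs : s ∈ X.chartSubmonoid k σ) (hsd : s ∈ X.coxPiece k d) :
    M.res h (M.chartMk hm hs hsd) = M.chartMk hm (X.chartSubmonoid_le k h hs) hsd := by
  refine Subtype.ext ?_
  change LocalizedModule.liftOfLE _ _ (X.chartSubmonoid_le k h) (LocalizedModule.mk m ⟨s, hs⟩) =
    LocalizedModule.mk m ⟨s, X.chartSubmonoid_le k h hs⟩
  simpa [← IsLocalizedModule.mk_eq_mk'] using
    IsLocalizedModule.liftOfLE_mk' _ _ (X.chartSubmonoid_le k h)
      (LocalizedModule.mkLinearMap (X.chartSubmonoid k σ) M.carrier)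
      (LocalizedModule.mkLinearMap (X.chartSubmonoid k τ) M.carrier) m ⟨s, hs⟩

theorem Hom.res_chart (f : M.Hom N) {τ : Finset (Fin r)} (h : τ ⊆ σ) (y : M.chart σ) :
    N.res h (f.chart σ y) = f.chart τ (M.res h y) := by
  obtain ⟨d, m, s, hm, hs, hsd, rfl⟩ := exists_eq_chartMk y
  rw [f.chart_chartMk, res_chartMk, res_chartMk, f.chart_chartMk]

theorem chartRingMk_smul_chartMk {f t : X.Cox k} (hf : f ∈ X.coxPiece k d)
    (hs : s ∈ X.chartSubmonoid k σ) (hsd : s ∈ X.coxPiece k d) (hm : m ∈ M.piece e)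
    (ht : t ∈ X.chartSubmonoid k σ) (hte : t ∈ X.coxPiece k e) :
    chartRingMk hf hs hsd • M.chartMk hm ht hte = M.chartMk (M.smul_mem hf hm) (mul_mem hs ht)
      (SetLike.mul_mem_graded hsd hte) :=
  Subtype.ext (LocalizedModule.mk_smul_mk _ _ _ _)

theorem chartMk_mem_range_iff (f : M.Hom N) {y : N.carrier} (hy : y ∈ N.piece d)
    (hs : s ∈ X.chartSubmonoid k σ) (hsd : s ∈ X.coxPiece k d) :
    N.chartMk hy hs hsd ∈ LinearMap.range (f.chart σ) ↔
      y ∈ saturation (X.chartSubmonoid k σ) (LinearMap.range f.toLinearMap) := by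
  refine ⟨fun ⟨z, hz⟩ => mk_mem_range_localizedModule_map_iff.1 ⟨z.1, congrArg Subtype.val hz⟩, ?_⟩
  rintro ⟨t, ht, x, hx⟩
  obtain ⟨j, hj⟩ := X.isHomogeneousElem_of_mem_chartSubmonoid ht
  have hfx : f.toLinearMap (DirectSum.decompose M.piece x (j + d)) = t • y := by
    rw [← decompose_map_of_mem (𝒩 := N.piece) fun _ _ hx => f.map_mem hx, hx,
      DirectSum.decompose_of_mem_same N.piece (N.smul_mem hj hy)]
  refine ⟨M.chartMk (SetLike.coe_mem (DirectSum.decompose M.piece x (j + d))) (mul_mem ht hs)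
    (SetLike.mul_mem_graded hj hsd), ?_⟩
  rw [f.chart_chartMk, chartMk_eq_iff]
  exact ⟨1, one_mem _, by rw [hfx, smul_comm s t y, mul_smul]⟩

theorem ker_le_saturation_of_exact (hσ : σ ∈ X.cones) (g : N.Hom M) (f : K.Hom N)
    (h : Function.Exact (f.chart σ) (g.chart σ)) :
    LinearMap.ker g.toLinearMap ≤
      saturation (X.chartSubmonoid k σ) (LinearMap.range f.toLinearMap) := by
  refine (isHomogeneous_le_iff g.isHomogeneous_ker).2 fun d x hx hgx => ?_
  obtain ⟨b, s, hs, t, ht, hsd, htb⟩ := X.exists_chartSubmonoid_degree k hσ d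
  rw [← smul_mem_saturation_iff ht, ← chartMk_mem_range_iff f (N.smul_mem htb hx) hs hsd]
  refine (h _).1 ?_
  rw [g.chart_chartMk, chartMk_eq_zero_iff, map_smul, LinearMap.mem_ker.1 hgx, smul_zero]
  exact zero_mem _

theorem saturation_colon_eq_of_exact (hσ : σ ∈ X.cones) (f : K.Hom N)
    (φ : N.chart σ →ₗ[X.chartRing k σ] M.chart σ) (h : Function.Exact (f.chart σ) φ)
    {y : N.carrier} {q : X.Cox k} (hy : y ∈ N.piece e) (hq : q ∈ X.chartSubmonoid k σ)
    (hqe : q ∈ X.coxPiece k e) (hm : m ∈ M.piece d) (hs : s ∈ X.chartSubmonoid k σ)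
    (hsd : s ∈ X.coxPiece k d) (hφ : φ (N.chartMk hy hq hqe) = M.chartMk hm hs hsd) :
    (saturation (X.chartSubmonoid k σ) (LinearMap.range f.toLinearMap)).colon {y} =
      (saturation (X.chartSubmonoid k σ) ⊥).colon {m} := by
  have hiff (i : X.Pic) (p : X.Cox k) (hp : p ∈ X.coxPiece k i) :
      p • y ∈ saturation (X.chartSubmonoid k σ) (LinearMap.range f.toLinearMap) ↔
        p • m ∈ saturation (X.chartSubmonoid k σ) ⊥ := by
    obtain ⟨b, c, hc, t, ht, hci, htb⟩ := X.exists_chartSubmonoid_degree k hσ i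
    have hpt : t * p ∈ X.coxPiece k (b + i) := SetLike.mul_mem_graded htb hp
    have hφp := φ.map_smul (chartRingMk hpt hc hci) (N.chartMk hy hq hqe)
    rw [hφ, chartRingMk_smul_chartMk, chartRingMk_smul_chartMk] at hφp
    rw [← smul_mem_saturation_iff ht, ← smul_mem_saturation_iff (x := p • m) ht, smul_smul,
      smul_smul, ← chartMk_mem_range_iff f (N.smul_mem hpt hy) (mul_mem hc hq)
        (SetLike.mul_mem_graded hci hqe), ← chartMk_eq_zero_iff (M.smul_mem hpt hm)
        (mul_mem hc hs) (SetLike.mul_mem_graded hci hsd), ← hφp]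
    exact (h _).symm
  have hyhom : ((saturation (X.chartSubmonoid k σ)
      (LinearMap.range f.toLinearMap)).colon {y}).IsHomogeneous (X.coxPiece k) :=
    isHomogeneous_colon_singleton
      (isHomogeneous_saturation_chartSubmonoid f.isHomogeneous_range) hy
  have hmhom : ((saturation (X.chartSubmonoid k σ) ⊥).colon {m}).IsHomogeneous (X.coxPiece k) :=
    isHomogeneous_colon_singleton (isHomogeneous_saturation_chartSubmonoid isHomogeneous_bot) hm
  refine le_antisymm ((isHomogeneous_le_iff hyhom).2 fun i p hp hpy => ?_)
    ((isHomogeneous_le_iff hmhom).2 fun i p hp hpm => ?_)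
  · exact Submodule.mem_colon_singleton.2 ((hiff i p hp).1 (Submodule.mem_colon_singleton.1 hpy))
  · exact Submodule.mem_colon_singleton.2 ((hiff i p hp).2 (Submodule.mem_colon_singleton.1 hpm))

theorem sheafNeZero_iff : M.SheafNeZero ↔ ∃ σ ∈ X.cones, ∃ d, ∃ m ∈ M.piece d,
    m ∉ saturation (X.chartSubmonoid k σ) ⊥ := by
  constructor
  · rintro ⟨σ, hσ, h⟩
    obtain ⟨y, hy⟩ := exists_ne (0 : M.chart σ)
    obtain ⟨d, m, s, hm, hs, hsd, rfl⟩ := exists_eq_chartMk y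
    exact ⟨σ, hσ, d, m, hm, fun h => hy ((chartMk_eq_zero_iff hm hs hsd).2 h)⟩
  · rintro ⟨σ, hσ, d, m, hm, h⟩
    obtain ⟨b, s, hs, t, ht, hsd, htb⟩ := X.exists_chartSubmonoid_degree k hσ d
    refine ⟨σ, hσ, M.chartMk (M.smul_mem htb hm) hs hsd, 0, fun h0 => h ?_⟩
    rwa [chartMk_eq_zero_iff, smul_mem_saturation_iff ht] at h0

/-! ### The codimension is at most the virtual dimension -/

theorem mem_support_of_colon_le {P : X.Point k}
    (h : (⊥ : Submodule (X.Cox k) M.carrier).colon {m} ≤ P.1.asIdeal) : P ∈ M.support :=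
  Module.mem_support_iff_exists_annihilator.2 ⟨m, fun _ hf => h <| Submodule.mem_colon_singleton.2
    ((Submodule.mem_annihilator_span_singleton _ _).1 hf)⟩

theorem exists_colon_le_of_mem_support {P : X.Point k} (h : P ∈ M.support) :
    ∃ d, ∃ m ∈ M.piece d, (⊥ : Submodule (X.Cox k) M.carrier).colon {m} ≤ P.1.asIdeal := by
  obtain ⟨m, hm⟩ := Module.mem_support_iff_exists_annihilator.1 h
  have := P.1.isPrime
  obtain ⟨d, hd⟩ := exists_colon_decompose_le M.piece (N := ⊥) (x := m) fun f hf =>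
    hm ((Submodule.mem_annihilator_span_singleton _ _).2 (Submodule.mem_colon_singleton.1 hf))
  exact ⟨d, _, SetLike.coe_mem _, hd⟩

theorem exists_saturation_colon_eq_point (hσ : σ ∈ X.cones) (hm : m ∈ M.piece d)
    (h : m ∉ saturation (X.chartSubmonoid k σ) ⊥) :
    ∃ P ∈ M.support, ∃ e, ∃ z ∈ M.piece e,
      (saturation (X.chartSubmonoid k σ) ⊥).colon {z} = P.1.asIdeal := by
  obtain ⟨P, hP⟩ := Ideal.nonempty_minimalPrimes (I := (saturation (X.chartSubmonoid k σ)
    (⊥ : Submodule (X.Cox k) M.carrier)).colon {m}) fun htop =>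
      h ((Submodule.colon_eq_top_iff_subset _).1 htop rfl)
  have hPprime : P.IsPrime := hP.1.1
  have hhom := isHomogeneous_saturation_chartSubmonoid (M := M) (σ := σ) isHomogeneous_bot
  have hPhom := isHomogeneous_of_mem_minimalPrimes
    (isHomogeneous_colon_singleton (𝒜 := X.coxPiece k) hhom hm) hP
  obtain ⟨e, z, hz, hzP⟩ := exists_homogeneous_colon_eq_of_mem_minimalPrimes (X.coxPiece k)
    hhom hm hP
  have hPX := X.not_irrelevantIdeal_le hσ (le_primeCompl_of_saturation_colon_eq hzP)
  refine ⟨⟨⟨P, hPprime⟩, hPhom, hPX⟩, mem_support_of_colon_le (m := z) ?_, e, z, hz, hzP⟩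
  exact (Submodule.colon_mono (le_saturation _ _) subset_rfl).trans hzP.le

theorem exists_mem_support_height_le (hM : M.SheafNeZero) {F : FreeComplex X k}
    (hF : M.IsVirtualResolution F) {L : ℕ} (hL : ∀ i, L < i → IsEmpty (F.gen i)) :
    ∃ P ∈ M.support, P.1.asIdeal.height ≤ L := by
  obtain ⟨σ, hσ, d, m, hm, hm0⟩ := sheafNeZero_iff.1 hM
  obtain ⟨P, hPM, e, z, hz, hzP⟩ := exists_saturation_colon_eq_point hσ hm hm0
  obtain ⟨ε, hε⟩ := hF
  obtain ⟨hsurj, hex0, hex⟩ := hε σ hσ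
  obtain ⟨b, s, hs, t, ht, hsd, htb⟩ := X.exists_chartSubmonoid_degree k hσ e
  obtain ⟨y, hy⟩ := hsurj (M.chartMk (M.smul_mem htb hz) hs hsd)
  obtain ⟨c, v, q, hv, hq, hqc, rfl⟩ := exists_eq_chartMk y
  have := P.1.isPrime
  have hvP : (saturation (X.chartSubmonoid k σ) (LinearMap.range (F.d 0).toLinearMap)).colon {v} =
      P.1.asIdeal := by
    rw [saturation_colon_eq_of_exact hσ (F.d 0) _ hex0 hv hq hqc _ hs hsd hy, ← hzP]
    ext f
    rw [Submodule.mem_colon_singleton, Submodule.mem_colon_singleton, smul_comm,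
      smul_mem_saturation_iff ht]
  have hT : X.chartSubmonoid k σ ≤ P.1.asIdeal.primeCompl :=
    le_primeCompl_of_saturation_colon_eq hvP
  refine ⟨P, hPM, height_le_of_flat_complex (d := fun i => (F.d i).toLinearMap)
    (G := fun i => F.gen i → X.Cox k) (fun i hi => ?_) F.d_comp_d (fun i => ?_)
    (saturation_primeCompl_colon_eq hvP)⟩
  · have := hL i hi
    infer_instance
  · exact (ker_le_saturation_of_exact hσ (F.d i) (F.d (i + 1)) (hex i)).trans
      (saturation_mono_left hT)

theorem codim_le_vdim (hM : M.SheafNeZero) : M.codim ≤ M.vdim := by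
  refine le_sInf ?_
  rintro _ ⟨L, F, rfl, hL, hF⟩
  obtain ⟨P, hP, hle⟩ := exists_mem_support_height_le hM hF hL
  exact (iInf₂_le P hP).trans hle

theorem SheafNeZero.support_nonempty (h : M.SheafNeZero) : M.support.Nonempty := by
  obtain ⟨σ, hσ, d, m, hm, h0⟩ := sheafNeZero_iff.1 h
  obtain ⟨P, hP, -⟩ := exists_saturation_colon_eq_point hσ hm h0
  exact ⟨P, hP⟩

/-! ### Restriction to the parts of a disconnected support -/

theorem mem_of_isClosed_of_le {Z : Set (X.Point k)} (hZ : IsClosed Z) {P Q : X.Point k}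
    (hQ : Q ∈ Z) (h : Q ≤ P) : P ∈ Z := by
  obtain ⟨C, hC, rfl⟩ := isClosed_induced_iff.1 hZ
  obtain ⟨I, rfl⟩ := (PrimeSpectrum.isClosed_iff_zeroLocus _).1 hC
  exact fun f hf => h (hQ hf)

theorem mem_vanishingOn_iff {Z : Set (X.Point k)} (hm : m ∈ M.piece d) :
    m ∈ M.vanishingOn Z ↔
      ∀ P ∈ Z, ¬ (⊥ : Submodule (X.Cox k) M.carrier).colon {m} ≤ P.1.asIdeal := by
  have hhom : ((⊥ : Submodule (X.Cox k) M.carrier).colon {m}).IsHomogeneous (X.coxPiece k) :=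
    isHomogeneous_colon_singleton isHomogeneous_bot hm
  refine forall₂_congr fun P _ => ?_
  rw [isHomogeneous_le_iff hhom]
  push Not
  simp only [Submodule.mem_colon_singleton, Submodule.mem_bot]
  exact exists₂_congr fun _ _ => and_congr_right' and_comm

theorem isHomogeneous_vanishingOn (Z : Set (X.Point k)) :
    (M.vanishingOn Z).IsHomogeneous M.piece := by
  intro e x hx P hP
  obtain ⟨d, f, hf, hfP, hfx⟩ := hx P hP
  refine ⟨d, f, hf, hfP, ?_⟩
  rw [← decompose_smul_of_left_mem (𝒜 := X.coxPiece k) (ℳ := M.piece) hf, hfx,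
    DirectSum.decompose_zero, DirectSum.zero_apply, ZeroMemClass.coe_zero]

theorem vanishingOn_colon_le {Z : Set (X.Point k)} {P : X.Point k} (hP : P ∈ Z)
    (h : (⊥ : Submodule (X.Cox k) M.carrier).colon {m} ≤ P.1.asIdeal) :
    (M.vanishingOn Z).colon {m} ≤ P.1.asIdeal := by
  intro f hf
  obtain ⟨d, g, -, hgP, hg⟩ := Submodule.mem_colon_singleton.1 hf P hP
  have hgf : g * f ∈ P.1.asIdeal := h (by rwa [Submodule.mem_colon_singleton, mul_smul])
  exact (P.1.isPrime.mem_or_mem hgf).resolve_left hgP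

theorem mem_of_vanishingOn_colon_le {Z : Set (X.Point k)} (hZ : IsClosed Z)
    (hgen : ∀ P ∈ M.support, ∀ Q ∈ Z, P ≤ Q → P ∈ Z) {P : X.Point k} (hm : m ∈ M.piece d)
    (h : (M.vanishingOn Z).colon {m} ≤ P.1.asIdeal) : P ∈ Z := by
  have := P.1.isPrime
  obtain ⟨P', hP', hP'P⟩ := Ideal.exists_minimalPrimes_le h
  have hP'hom := isHomogeneous_of_mem_minimalPrimes
    (isHomogeneous_colon_singleton (𝒜 := X.coxPiece k) (isHomogeneous_vanishingOn Z) hm) hP'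
  obtain ⟨e, z, hz, rfl⟩ := exists_homogeneous_colon_eq_of_mem_minimalPrimes (X.coxPiece k)
    (isHomogeneous_vanishingOn Z) hm hP'
  have hprime : ((M.vanishingOn Z).colon {z}).IsPrime := hP'.1.1
  have hzZ : z ∉ M.vanishingOn Z := fun hz' =>
    hprime.ne_top ((Submodule.colon_eq_top_iff_subset _).2 (Set.singleton_subset_iff.2 hz'))
  rw [mem_vanishingOn_iff hz] at hzZ
  push Not at hzZ
  obtain ⟨Q, hQ, hzQ⟩ := hzZ
  let P₀ : X.Point k := ⟨⟨_, hprime⟩, hP'hom, fun hle => P.2.2 (hle.trans hP'P)⟩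
  have hP₀ : P₀ ∈ M.support :=
    mem_support_of_colon_le (m := z) (Submodule.colon_mono bot_le subset_rfl)
  exact mem_of_isClosed_of_le hZ (hgen P₀ hP₀ Q hQ (vanishingOn_colon_le hQ hzQ)) hP'P

theorem support_restrict {Z : Set (X.Point k)} (hZ : IsClosed Z)
    (hgen : ∀ P ∈ M.support, ∀ Q ∈ Z, P ≤ Q → P ∈ Z) (hsub : Z ⊆ M.support) :
    (M.restrict Z).support = Z := by
  have hcolon (x : M.carrier) :
      (⊥ : Submodule (X.Cox k) (M.restrict Z).carrier).colon {(M.vanishingOn Z).mkQ x} =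
        (M.vanishingOn Z).colon {x} := by
    ext f
    exact Submodule.mem_colon_singleton.trans
      ((Submodule.Quotient.mk_eq_zero (M.vanishingOn Z)).trans Submodule.mem_colon_singleton.symm)
  refine subset_antisymm (fun P hP => ?_) fun P hP => ?_
  · obtain ⟨d, _, ⟨x, hx, rfl⟩, hxP⟩ := exists_colon_le_of_mem_support hP
    exact mem_of_vanishingOn_colon_le hZ hgen hx ((hcolon x).symm.trans_le hxP)
  · obtain ⟨d, x, -, hxP⟩ := exists_colon_le_of_mem_support (hsub hP)
    exact mem_support_of_colon_le ((hcolon x).trans_le (vanishingOn_colon_le hP hxP))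

/-- The quotient map from `M` to its restriction to `Z`. -/
noncomputable def toRestrict (M : GradedModule.{u, v} X k) (Z : Set (X.Point k)) :
    M.Hom (M.restrict Z) where
  toLinearMap := (M.vanishingOn Z).mkQ
  map_mem hm := ⟨_, hm, rfl⟩

theorem Hom.chart_chartMk_eq_zero_iff (f : M.Hom N) (hm : m ∈ M.piece d)
    (hs : s ∈ X.chartSubmonoid k σ) (hsd : s ∈ X.coxPiece k d) :
    f.chart σ (M.chartMk hm hs hsd) = 0 ↔
      m ∈ saturation (X.chartSubmonoid k σ) (LinearMap.ker f.toLinearMap) := by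
  rw [f.chart_chartMk, chartMk_eq_zero_iff]
  simp only [mem_saturation, Submodule.mem_bot, LinearMap.mem_ker, map_smul]

theorem ker_toRestrict (Z : Set (X.Point k)) :
    LinearMap.ker (M.toRestrict Z).toLinearMap = M.vanishingOn Z :=
  Submodule.ker_mkQ _

section DisjointUnion

variable {ι : Type*} {Z : ι → Set (X.Point k)}

theorem mem_of_le_of_disjoint (hclosed : ∀ i, IsClosed (Z i))
    (hdisj : Pairwise fun i j => Disjoint (Z i) (Z j)) (hunion : ⋃ i, Z i = M.support) (i : ι) :
    ∀ P ∈ M.support, ∀ Q ∈ Z i, P ≤ Q → P ∈ Z i := by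
  intro P hP Q hQ hPQ
  obtain ⟨j, hj⟩ := Set.mem_iUnion.1 (hunion.ge hP)
  obtain rfl : i = j := by
    by_contra hij
    exact Set.disjoint_left.1 (hdisj hij) hQ (mem_of_isClosed_of_le (hclosed j) hj hPQ)
  exact hj

theorem eq_zero_of_forall_toRestrict_chart_eq_zero (hσ : σ ∈ X.cones)
    (hunion : ⋃ i, Z i = M.support) {y : M.chart σ}
    (hy : ∀ i, (M.toRestrict (Z i)).chart σ y = 0) : y = 0 := by
  obtain ⟨d, m, s, hm, hs, hsd, rfl⟩ := exists_eq_chartMk y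
  simp only [Hom.chart_chartMk_eq_zero_iff, ker_toRestrict] at hy
  set J := (saturation (X.chartSubmonoid k σ) (⊥ : Submodule (X.Cox k) M.carrier)).colon {m}
  have hJ : J.IsHomogeneous (X.coxPiece k) := isHomogeneous_colon_singleton
    (isHomogeneous_saturation_chartSubmonoid isHomogeneous_bot) hm
  have hJP (P : X.Point k) : ¬ J ≤ P.1.asIdeal := by
    intro hle
    have hP : P ∈ M.support := mem_support_of_colon_le (m := m)
      ((Submodule.colon_mono (le_saturation _ _) subset_rfl).trans hle)
    obtain ⟨i, hi⟩ := Set.mem_iUnion.1 (hunion.ge hP)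
    obtain ⟨t, ht, htm⟩ := hy i
    obtain ⟨e, g, -, hgP, hg⟩ := htm P hi
    exact hgP (hle (Submodule.mem_colon_singleton.2 ⟨t, ht, by rwa [smul_comm]⟩))
  obtain ⟨t, ht, htJ⟩ := X.exists_mem_chartSubmonoid_of_forall_point hσ hJ hJP
  rw [chartMk_eq_zero_iff, ← smul_mem_saturation_iff ht]
  exact Submodule.mem_colon_singleton.1 htJ

theorem exists_smul_mem_vanishingOn_sup [Finite ι] (hσ : σ ∈ X.cones)
    (hclosed : ∀ i, IsClosed (Z i)) (hdisj : Pairwise fun i j => Disjoint (Z i) (Z j))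
    (hunion : ⋃ i, Z i = M.support) (i : ι) (hm : m ∈ M.piece d) :
    ∃ t ∈ X.chartSubmonoid k σ,
      t • m ∈ M.vanishingOn (Z i) ⊔ ⨅ j : {j // j ≠ i}, M.vanishingOn (Z j) := by
  have := Fintype.ofFinite {j // j ≠ i}
  have hgen := mem_of_le_of_disjoint hclosed hdisj hunion
  set W := M.vanishingOn (Z i) ⊔ ⨅ j : {j // j ≠ i}, M.vanishingOn (Z j)
  have hW : (W.colon {m}).IsHomogeneous (X.coxPiece k) := isHomogeneous_colon_singleton
    (isHomogeneous_sup (isHomogeneous_vanishingOn _)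
      (isHomogeneous_iInf fun j : {j // j ≠ i} => isHomogeneous_vanishingOn (Z j))) hm
  have hWP (P : X.Point k) : ¬ W.colon {m} ≤ P.1.asIdeal := by
    intro hle
    have hPi : P ∈ Z i := mem_of_vanishingOn_colon_le (hclosed i) (hgen i) hm
      ((Submodule.colon_mono le_sup_left subset_rfl).trans hle)
    have hinf : Finset.univ.inf (fun j : {j // j ≠ i} => (M.vanishingOn (Z j)).colon {m}) ≤
        P.1.asIdeal := by
      rw [Finset.inf_univ_eq_iInf, ← Submodule.iInf_colon]
      exact (Submodule.colon_mono le_sup_right subset_rfl).trans hle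
    obtain ⟨j, -, hj⟩ := (Ideal.IsPrime.inf_le' P.1.isPrime).1 hinf
    exact Set.disjoint_left.1 (hdisj j.2)
      (mem_of_vanishingOn_colon_le (hclosed j) (hgen j) hm hj) hPi
  obtain ⟨t, ht, htW⟩ := X.exists_mem_chartSubmonoid_of_forall_point hσ hW hWP
  exact ⟨t, ht, Submodule.mem_colon_singleton.1 htW⟩

theorem exists_toRestrict_chart_eq [Finite ι] (hσ : σ ∈ X.cones)
    (hclosed : ∀ i, IsClosed (Z i)) (hdisj : Pairwise fun i j => Disjoint (Z i) (Z j))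
    (hunion : ⋃ i, Z i = M.support) (i : ι) (x : (M.restrict (Z i)).chart σ) :
    ∃ y : M.chart σ, (M.toRestrict (Z i)).chart σ y = x ∧
      ∀ j ≠ i, (M.toRestrict (Z j)).chart σ y = 0 := by
  obtain ⟨d, _, s, ⟨m, hm, rfl⟩, hs, hsd, rfl⟩ := exists_eq_chartMk x
  obtain ⟨t, ht, htm⟩ := exists_smul_mem_vanishingOn_sup hσ hclosed hdisj hunion i hm
  obtain ⟨e, he⟩ := X.isHomogeneousElem_of_mem_chartSubmonoid ht
  obtain ⟨a, ha, b, hb, -, hbd, hab⟩ := exists_homogeneous_add_eq_of_mem_sup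
    (isHomogeneous_vanishingOn _)
    (isHomogeneous_iInf fun j : {j // j ≠ i} => isHomogeneous_vanishingOn (Z j))
    (M.smul_mem he hm) htm
  refine ⟨M.chartMk hbd (mul_mem ht hs) (SetLike.mul_mem_graded he hsd), ?_, fun j hj => ?_⟩
  · have hbm : (M.vanishingOn (Z i)).mkQ b = t • (M.vanishingOn (Z i)).mkQ m := by
      rw [← map_smul, ← hab, map_add, Submodule.mkQ_apply _ a,
        (Submodule.Quotient.mk_eq_zero _).2 ha, zero_add]
    rw [Hom.chart_chartMk]
    refine (chartMk_eq_iff (M := M.restrict (Z i)) _ _ _ _ _ _).2 ⟨1, one_mem _, ?_⟩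
    exact congrArg _ ((congrArg (s • ·) hbm).trans
      ((smul_smul s t _).trans (congrArg (· • (M.vanishingOn (Z i)).mkQ m) (mul_comm s t))))
  · rw [Hom.chart_chartMk_eq_zero_iff, ker_toRestrict]
    exact le_saturation _ _ ((Submodule.mem_iInf _).1 hb ⟨j, hj⟩)

end DisjointUnion

/-! ### Direct sums of virtual resolutions -/

theorem bijective_chart_pi {ι : Type*} [Finite ι] {N : ι → GradedModule.{u, w} X k}
    {p : ∀ i, M.Hom (N i)} (h₁ : ∀ y, (∀ i, (p i).chart σ y = 0) → y = 0)
    (h₂ : ∀ i (x : (N i).chart σ), ∃ y, (p i).chart σ y = x ∧ ∀ j ≠ i, (p j).chart σ y = 0) :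
    Function.Bijective (LinearMap.pi fun i => (p i).chart σ) := by
  have := Fintype.ofFinite ι
  refine ⟨(injective_iff_map_eq_zero _).2 fun y hy => h₁ y (congrFun hy), fun x => ?_⟩
  choose y hy hy' using fun i => h₂ i (x i)
  refine ⟨∑ i, y i, funext fun i => ?_⟩
  rw [LinearMap.pi_apply, map_sum, Finset.sum_eq_single i (fun j _ h => hy' j i h.symm)
    fun h => absurd (Finset.mem_univ i) h, hy i]

section Free

variable {ι : Type} [Fintype ι] {J J' : ι → Type} [∀ i, Fintype (J i)] [∀ i, Fintype (J' i)]
  {a : ∀ i, J i → X.Pic} {b : ∀ i, J' i → X.Pic}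

/-- The projection of a direct sum of free graded modules to a summand. -/
noncomputable def freeProj (a : ∀ i, J i → X.Pic) (i : ι) :
    (free X k fun j : Σ i, J i => a j.1 j.2).Hom (free X k (a i)) where
  toLinearMap := LinearMap.funLeft (X.Cox k) (X.Cox k) (Sigma.mk i)
  map_mem hm j := hm ⟨i, j⟩

/-- The inclusion of a summand into a direct sum of free graded modules. -/
noncomputable def freeIncl (a : ∀ i, J i → X.Pic) (i : ι) :
    (free X k (a i)).Hom (free X k fun j : Σ i, J i => a j.1 j.2) where
  toLinearMap := Function.ExtendByZero.linearMap (X.Cox k) (Sigma.mk i)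
  map_mem := by
    intro d (m : J i → X.Cox k) hm j
    change Function.extend (Sigma.mk i) m 0 j ∈ X.coxPiece k (d - a j.1 j.2)
    by_cases hj : ∃ l, Sigma.mk i l = j
    · obtain ⟨l, rfl⟩ := hj
      rw [sigma_mk_injective.extend_apply]
      exact hm l
    · rw [Function.extend_apply' _ _ _ hj]
      exact zero_mem _

/-- The direct sum of homomorphisms of free graded modules. -/
noncomputable def freeMap (f : ∀ i, (free X k (a i)).Hom (free X k (b i))) :
    (free X k fun j : Σ i, J i => a j.1 j.2).Hom (free X k fun j : Σ i, J' i => b j.1 j.2) where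
  toLinearMap := LinearMap.pi (φ := fun _ => X.Cox k) fun j =>
    (LinearMap.proj (φ := fun _ => X.Cox k) j.2 : (J' j.1 → X.Cox k) →ₗ[X.Cox k] X.Cox k) ∘ₗ
      (f j.1).toLinearMap ∘ₗ (freeProj a j.1).toLinearMap
  map_mem hm j := (f j.1).map_mem ((freeProj a j.1).map_mem hm) j.2

theorem freeProj_freeIncl (i : ι) (m : (free X k (a i)).carrier) :
    (freeProj a i).toLinearMap ((freeIncl a i).toLinearMap m) = m :=
  Function.extend_comp (sigma_mk_injective (β := J)) (m : J i → X.Cox k) 0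

theorem freeProj_freeIncl_of_ne {i j : ι} (h : j ≠ i) (m : (free X k (a i)).carrier) :
    (freeProj a j).toLinearMap ((freeIncl a i).toLinearMap m) = 0 :=
  funext fun l => Function.extend_apply' (f := Sigma.mk i) (m : J i → X.Cox k) 0 ⟨j, l⟩
    fun ⟨_, hl⟩ => h (congrArg Sigma.fst hl).symm

theorem free_ext {x y : (free X k fun j : Σ i, J i => a j.1 j.2).carrier}
    (h : ∀ i, (freeProj a i).toLinearMap x = (freeProj a i).toLinearMap y) : x = y :=
  funext fun j => congrFun (h j.1) j.2

theorem freeProj_chart_freeMap (f : ∀ i, (free X k (a i)).Hom (free X k (b i))) (i : ι)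
    (y : (free X k fun j : Σ i, J i => a j.1 j.2).chart σ) :
    (freeProj b i).chart σ ((freeMap f).chart σ y) = (f i).chart σ ((freeProj a i).chart σ y) := by
  obtain ⟨d, m, s, hm, hs, hsd, rfl⟩ := exists_eq_chartMk y
  simp only [Hom.chart_chartMk]
  rfl

theorem bijective_freeProj_chart (a : ∀ i, J i → X.Pic) (σ : Finset (Fin r)) :
    Function.Bijective (LinearMap.pi fun i => (freeProj (k := k) a i).chart σ) := by
  refine bijective_chart_pi (fun y hy => ?_) fun i x => ⟨(freeIncl a i).chart σ x, ?_, ?_⟩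
  · obtain ⟨d, m, s, hm, hs, hsd, rfl⟩ := exists_eq_chartMk y
    choose t ht htm using fun i => (Hom.chart_chartMk_eq_zero_iff (freeProj a i) hm hs hsd).1 (hy i)
    refine (chartMk_eq_zero_iff hm hs hsd).2
      ⟨∏ i, t i, prod_mem fun i _ => ht i, free_ext fun i => ?_⟩
    obtain ⟨c, hc⟩ := Finset.dvd_prod_of_mem t (Finset.mem_univ i)
    rw [hc, mul_comm, mul_smul, map_smul, LinearMap.mem_ker.1 (htm i), smul_zero, map_zero]
  · obtain ⟨d, m, s, hm, hs, hsd, rfl⟩ := exists_eq_chartMk x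
    simp only [Hom.chart_chartMk, freeProj_freeIncl]
  · intro j hj
    obtain ⟨d, m, s, hm, hs, hsd, rfl⟩ := exists_eq_chartMk x
    rw [Hom.chart_chartMk, Hom.chart_chartMk_eq_zero_iff]
    exact le_saturation _ _ (LinearMap.mem_ker.2 (freeProj_freeIncl_of_ne hj m))

end Free

end GradedModule

open GradedModule

namespace FreeComplex

variable {ι : Type} [Fintype ι]

/-- The direct sum of complexes of free graded modules. -/
noncomputable def directSum (F : ι → FreeComplex X k) : FreeComplex X k where
  gen l := Σ i, (F i).gen l
  deg l j := (F j.1).deg l j.2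
  d l := freeMap fun i => (F i).d l
  d_comp_d l := LinearMap.ext fun x => free_ext (a := fun i => (F i).deg l) fun i =>
    LinearMap.congr_fun ((F i).d_comp_d l)
      ((freeProj (fun i => (F i).deg (l + 1 + 1)) i).toLinearMap x)

variable {F : ι → FreeComplex X k}

theorem exact_directSum
    (h : ∀ i l, Function.Exact (((F i).d (l + 1)).chart σ) (((F i).d l).chart σ)) (l : ℕ) :
    Function.Exact (((directSum F).d (l + 1)).chart σ) (((directSum F).d l).chart σ) :=
  exact_of_forall_exact
    (α := fun i => (freeProj (k := k) (fun i => (F i).deg (l + 2)) i).chart σ)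
    (β := fun i => (freeProj (k := k) (fun i => (F i).deg (l + 1)) i).chart σ)
    (γ := fun i => (freeProj (k := k) (fun i => (F i).deg l) i).chart σ)
    (f' := fun i => ((F i).d (l + 1)).chart σ) (g' := fun i => ((F i).d l).chart σ)
    (bijective_freeProj_chart (fun i => (F i).deg (l + 2)) σ).2
    (bijective_freeProj_chart (fun i => (F i).deg (l + 1)) σ).1
    (bijective_freeProj_chart (fun i => (F i).deg l) σ).1
    (fun i => map_zero ((freeProj (fun i => (F i).deg l) i).chart σ))
    (fun i => freeProj_chart_freeMap (fun i => (F i).d (l + 1)) i)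
    (fun i => freeProj_chart_freeMap (fun i => (F i).d l) i) fun i => h i l

theorem exact_directSum_augmentation {M : GradedModule.{u, v} X k}
    {N : ι → GradedModule.{u, w} X k} {p : ∀ i, M.Hom (N i)}
    (hp : Function.Injective (LinearMap.pi fun i => (p i).chart σ))
    {E : (free X k ((directSum F).deg 0)).chart σ →ₗ[X.chartRing k σ] M.chart σ}
    {ε : ∀ i, (free X k ((F i).deg 0)).chart σ →ₗ[X.chartRing k σ] (N i).chart σ}
    (hE : ∀ i y, (p i).chart σ (E y) = ε i ((freeProj (fun i => (F i).deg 0) i).chart σ y))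
    (h : ∀ i, Function.Exact (((F i).d 0).chart σ) (ε i)) :
    Function.Exact (((directSum F).d 0).chart σ) E :=
  exact_of_forall_exact
    (α := fun i => (freeProj (k := k) (fun i => (F i).deg (0 + 1)) i).chart σ)
    (β := fun i => (freeProj (k := k) (fun i => (F i).deg 0) i).chart σ)
    (γ := fun i => (p i).chart σ) (f' := fun i => ((F i).d 0).chart σ) (g' := fun i => ε i)
    (bijective_freeProj_chart (fun i => (F i).deg (0 + 1)) σ).2
    (bijective_freeProj_chart (fun i => (F i).deg 0) σ).1 hp
    (fun i => map_zero ((p i).chart σ))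
    (fun i => freeProj_chart_freeMap (fun i => (F i).d 0) i) hE h

end FreeComplex

namespace GradedModule

variable {M : GradedModule.{u, v} X k}

theorem IsVirtualResolution.directSum {ι : Type} [Fintype ι] {N : ι → GradedModule.{u, w} X k}
    {p : ∀ i, M.Hom (N i)}
    (hp : ∀ σ ∈ X.cones, Function.Bijective (LinearMap.pi fun i => (p i).chart σ))
    {F : ι → FreeComplex X k} (hF : ∀ i, (N i).IsVirtualResolution (F i)) :
    M.IsVirtualResolution (FreeComplex.directSum F) := by
  choose ε hε using hF
  let q (i : ι) := freeProj (k := k) (fun i => (F i).deg 0) i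
  obtain ⟨E, hE⟩ : ∃ E : ∀ σ ∈ X.cones,
      (free X k ((FreeComplex.directSum F).deg 0)).chart σ →ₗ[X.chartRing k σ] M.chart σ,
      ∀ σ hσ i y, (p i).chart σ (E σ hσ y) = (ε i).app σ hσ ((q i).chart σ y) :=
    ⟨fun σ hσ => (LinearEquiv.ofBijective _ (hp σ hσ)).symm.toLinearMap ∘ₗ
      LinearMap.pi fun i => (ε i).app σ hσ ∘ₗ (q i).chart σ,
      fun σ hσ i y => congrFun ((LinearEquiv.ofBijective _ (hp σ hσ)).apply_symm_apply _) i⟩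
  have hnat {σ τ : Finset (Fin r)} (hσ : σ ∈ X.cones) (hτ : τ ∈ X.cones) (h : τ ⊆ σ) (y) :
      E τ hτ (res _ h y) = M.res h (E σ hσ y) := by
    refine (hp τ hτ).1 (funext fun i => ?_)
    rw [LinearMap.pi_apply, LinearMap.pi_apply, hE, ← Hom.res_chart, hE, ← (ε i).naturality]
    exact congrArg _ ((q i).res_chart h y).symm
  refine ⟨⟨E, hnat⟩, fun σ hσ => ⟨fun x => ?_, ?_, ?_⟩⟩
  · choose z hz using fun i => (hε i σ hσ).1 ((p i).chart σ x)
    obtain ⟨y, hy⟩ := (bijective_freeProj_chart (fun i => (F i).deg 0) σ).2 z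
    refine ⟨y, (hp σ hσ).1 (funext fun i => ?_)⟩
    exact (hE σ hσ i y).trans ((congrArg ((ε i).app σ hσ) (congrFun hy i)).trans (hz i))
  · exact FreeComplex.exact_directSum_augmentation (hp σ hσ).1 (hE σ hσ) fun i => (hε i σ hσ).2.1
  · exact FreeComplex.exact_directSum fun i => (hε i σ hσ).2.2

/-! ### Virtually Cohen–Macaulay modules with disconnected support -/

theorem exists_minimal_height_eq_codim (h : M.support.Nonempty) :
    ∃ P, Minimal (· ∈ M.support) P ∧ P.1.asIdeal.height = M.codim := by
  have : Nonempty M.support := h.to_subtype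
  obtain ⟨⟨P, hP⟩, hPc⟩ := ciInf_mem fun P : M.support => P.1.1.asIdeal.height
  replace hPc : P.1.asIdeal.height = M.codim := by rw [codim, iInf_subtype']; exact hPc
  refine ⟨P, ⟨hP, fun Q hQ hQP => ?_⟩, hPc⟩
  have := P.1.isPrime
  have := Q.1.isPrime
  by_contra hPQ
  have hlt : Q.1.asIdeal < P.1.asIdeal := lt_of_le_not_ge hQP hPQ
  exact (Ideal.height_strict_mono_of_isPrime_of_isPrime hlt).not_ge (hPc.trans_le (iInf₂_le Q hQ))

theorem codim_ne_top (h : M.support.Nonempty) : M.codim ≠ ⊤ := by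
  obtain ⟨P, -, hP⟩ := exists_minimal_height_eq_codim h
  exact hP ▸ Ideal.height_ne_top P.1.isPrime.ne_top

theorem EquidimensionalSupport.height_eq (h : M.EquidimensionalSupport) {P Q : X.Point k}
    (hP : Minimal (· ∈ M.support) P) (hQ : Minimal (· ∈ M.support) Q) :
    P.1.asIdeal.height = Q.1.asIdeal.height := by
  have := P.1.isPrime
  have := Q.1.isPrime
  exact height_eq_of_ringKrullDim_quotient_eq _ _ (h P Q hP hQ)

theorem exists_isVirtualResolution_of_vdim_eq {L : ℕ} (h : M.vdim = L) :
    ∃ F : FreeComplex X k, (∀ i, L < i → IsEmpty (F.gen i)) ∧ M.IsVirtualResolution F := by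
  have hne : M.vdim ≠ ⊤ := h ▸ ENat.natCast_ne_top L
  obtain ⟨L', F, hL', hF⟩ : M.vdim ∈ {ℓ : ℕ∞ | ∃ (L : ℕ) (F : FreeComplex X k), ℓ = L ∧
      (∀ i, L < i → IsEmpty (F.gen i)) ∧ M.IsVirtualResolution F} :=
    csInf_mem (Set.nonempty_iff_ne_empty.2 fun h0 => hne (by rw [vdim, h0, sInf_empty]))
  obtain rfl : L = L' := Nat.cast_injective (h.symm.trans hL')
  exact ⟨F, hF⟩

section DisjointUnion

variable {ι : Type*} {Z : ι → Set (X.Point k)}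

theorem codim_restrict_eq (hM : M.EquidimensionalSupport) (hclosed : ∀ i, IsClosed (Z i))
    (hdisj : Pairwise fun i j => Disjoint (Z i) (Z j)) (hunion : ⋃ i, Z i = M.support) {i : ι}
    (hi : (M.restrict (Z i)).support.Nonempty) : (M.restrict (Z i)).codim = M.codim := by
  have hsub : Z i ⊆ M.support := (Set.subset_iUnion Z i).trans hunion.le
  have hgen := mem_of_le_of_disjoint hclosed hdisj hunion i
  have hsupp := support_restrict (hclosed i) hgen hsub
  obtain ⟨P, hP, hPc⟩ := exists_minimal_height_eq_codim hi
  rw [hsupp] at hi hP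
  obtain ⟨Q, hQ, hQc⟩ := exists_minimal_height_eq_codim (hi.mono hsub)
  rw [← hPc, ← hQc]
  exact hM.height_eq ⟨hsub hP.1, fun P' hP' hle => hP.2 (hgen P' hP' P hP.1 hle) hle⟩ hQ

theorem sheafNeZero_of_restrict [Finite ι] (hclosed : ∀ i, IsClosed (Z i))
    (hdisj : Pairwise fun i j => Disjoint (Z i) (Z j)) (hunion : ⋃ i, Z i = M.support) {i : ι}
    (h : (M.restrict (Z i)).SheafNeZero) : M.SheafNeZero := by
  obtain ⟨σ, hσ, hnt⟩ := h
  obtain ⟨x, hx⟩ := exists_ne (0 : (M.restrict (Z i)).chart σ)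
  obtain ⟨y, rfl, -⟩ := exists_toRestrict_chart_eq hσ hclosed hdisj hunion i x
  exact ⟨σ, hσ, y, 0, fun h => hx (by rw [h, map_zero])⟩

theorem bijective_toRestrict_chart [Finite ι] (hσ : σ ∈ X.cones) (hclosed : ∀ i, IsClosed (Z i))
    (hdisj : Pairwise fun i j => Disjoint (Z i) (Z j)) (hunion : ⋃ i, Z i = M.support) :
    Function.Bijective (LinearMap.pi fun i => (M.toRestrict (Z i)).chart σ) :=
  bijective_chart_pi (fun _ hy => eq_zero_of_forall_toRestrict_chart_eq_zero hσ hunion hy)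
    (exists_toRestrict_chart_eq hσ hclosed hdisj hunion)

theorem vdim_le_of_forall_restrict [Finite ι] (hclosed : ∀ i, IsClosed (Z i))
    (hdisj : Pairwise fun i j => Disjoint (Z i) (Z j)) (hunion : ⋃ i, Z i = M.support) {L : ℕ}
    (h : ∀ i, (M.restrict (Z i)).vdim = L) : M.vdim ≤ L := by
  obtain ⟨N, ⟨e⟩⟩ := Finite.exists_equiv_fin ι
  choose F hF hres using fun j : Fin N => exists_isVirtualResolution_of_vdim_eq (h (e.symm j))
  have hbij (σ) (hσ : σ ∈ X.cones) := bijective_toRestrict_chart (M := M) (Z := Z ∘ e.symm) hσ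
    (fun j => hclosed _) (hdisj.comp_of_injective e.symm.injective)
    ((e.symm.surjective.iUnion_comp Z).trans hunion)
  exact sInf_le ⟨L, FreeComplex.directSum F, rfl,
    fun l hl => ⟨fun j => (hF j.1 l hl).false j.2⟩, .directSum hbij hres⟩

end DisjointUnion

end GradedModule

end GradedModules

theorem mainTheorem9_general {n r : ℕ} (X : SmoothProjectiveFan n r) {k : Type u} [Field k]
    (M : GradedModule.{u, v} X k) (hM : M.EquidimensionalSupport)
    {ι : Type w} [Finite ι] [Nonempty ι] (Z : ι → Set (X.Point k))
    (hclosed : ∀ i, IsClosed (Z i))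
    (hdisj : Pairwise fun i j => Disjoint (Z i) (Z j))
    (hunion : ⋃ i, Z i = M.support)
    (h : ∀ i, (M.restrict (Z i)).IsVirtuallyCohenMacaulay) :
    M.IsVirtuallyCohenMacaulay := by
  have hM0 : M.SheafNeZero := GradedModule.sheafNeZero_of_restrict hclosed hdisj hunion
    (h (Classical.arbitrary ι)).1
  obtain ⟨c, hc⟩ := ENat.ne_top_iff_exists.1 (GradedModule.codim_ne_top hM0.support_nonempty)
  have hvdim (i : ι) : (M.restrict (Z i)).vdim = c := by
    rw [(h i).2, hc]
    exact GradedModule.codim_restrict_eq hM hclosed hdisj hunion (h i).1.support_nonempty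
  refine ⟨hM0, le_antisymm ?_ (GradedModule.codim_le_vdim hM0)⟩
  rw [← hc]
  exact GradedModule.vdim_le_of_forall_restrict hclosed hdisj hunion hvdim

theorem mainTheorem9 {n r : ℕ} (X : SmoothProjectiveFan n r)
    {k : Type u} [Field k] [IsAlgClosed k]
    (M : GradedModule.{u, v} X k) [Module.Finite (X.Cox k) M.carrier]
    (hM : M.EquidimensionalSupport)
    {ι : Type w} [Finite ι] [Nonempty ι] (Z : ι → Set (X.Point k))
    (hclosed : ∀ i, IsClosed (Z i))
    (hdisj : Pairwise fun i j => Disjoint (Z i) (Z j))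
    (hunion : ⋃ i, Z i = M.support)
    (h : ∀ i, (M.restrict (Z i)).IsVirtuallyCohenMacaulay) :
    M.IsVirtuallyCohenMacaulay :=
  mainTheorem9_general X M hM Z hclosed hdisj hunion h
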